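/- **Theorem (Fixing the Thom encodings with a sign).** Let $\mathbf R$ be a real closed field, $\mathbf K\subset\mathbf R$ a subfield with the induced order, $u=(u_1,\dots,u_k)$, and let $P,Q\in\mathbf K[u][y]$ with $P$ monic in $y$ of degree $p\ge 1$. *Elimination families.* For $A\in\mathbf K[u][y]$ let $\mathrm{Her}(P;A)$ be the $p\times p$ matrix over $\mathbf K[u]$ whose $(i,j)$ entry, $0\le i,j<p$, is the trace of multiplication by $A\,y^{i+j}$ on $\mathbf K[u][y]/(P)$, and let $\mathrm{HMi}(P;A)$ be the set of its leading principal minors of orders $1,\dots,p$. Let $\mathrm{PDer}_i(P)$ be the set of products $\prod_{1\le h\le p-1}(P^{(h)})^{\alpha_h}$ with $\alpha_h\in\{0,1,2\}$ and at most $i$ nonzero $\alpha_h$, where $P^{(h)}$ is the $h$-th derivative with respect to $y$, and let $\mathrm{PDer}_i(P;Q)=\{AB : A\in\mathrm{PDer}_i(P),\ B\in\{Q,Q^2\}\}$. With $\mathrm{bit}\{p\}$ the number of binary digits of $p$, put $$\mathrm{ThElim}(P)=\bigcup_{A\in\mathrm{PDer}_{\mathrm{bit}\{p\}}(P)}\mathrm{HMi}(P;A),\qquad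 \mathrm{ThElim}(P;Q)=\bigcup_{A\in\mathrm{PDer}_{\mathrm{bit}\{p\}-1}(P;Q)}\mathrm{HMi}(P;A).$$ For a sign condition $\tau\in\{-1,0,1\}^{S}$ on a set $S\subset\mathbf K[u]$, let $\mathrm{Real}(\tau,\mathbf R)$ be the set of $\upsilon\in\mathbf R^k$ with $\mathrm{sign}(H(\upsilon))=\tau(H)$ for all $H\in S$. *Root data.* A sign condition on $\mathrm{Der}(P)$ is an $\eta\in\{-1,0,1\}^{\{1,\dots,p-1\}}$; extend it to $\eta_+$ on $\{0,\dots,p\}$ by $\eta_+(p)=1$ and $\eta_+(0)=0$. Let $\mathrm{mu}(\eta)$ be the smallest $i$ with $\eta_+(i)\ne0$. Write $\eta_1\prec_P\eta_2$ if $\eta_1\neq\eta_2$ and, for the largest $q$ with $\eta_{1,+}(q)\ne\eta_{2,+}(q)$, either $\eta_{1,+}(q)<\eta_{2,+}(q)$ and $\eta_{1,+}(q+1)=1$, or $\eta_{1,+}(q)>\eta_{2,+}(q)$ and $\eta_{1,+}(q+1)=-1$. Write $\eta_1\prec^{\mathrm{mu}}_P\eta_2$ if $\mathrm{mu}(\eta_1)>\mathrm{mu}(\eta_2)$,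 or $\mathrm{mu}(\eta_1)=\mathrm{mu}(\eta_2)$ and $\eta_1\prec_P\eta_2$. *Root data of degree $p$* are triples $(\mu,\nu,\eta)$ where $\mu=(\mu_1\ge\dots\ge\mu_r)$ and $\nu=(\nu_1\ge\dots\ge\nu_s)$ are lists of positive integers with $\sum_j\mu_j+2\sum_k\nu_k=p$, and $\eta=[\eta_1,\dots,\eta_r]$ is a list of distinct sign conditions on $\mathrm{Der}(P)$ with $\eta_i\prec^{\mathrm{mu}}_P\eta_j$ for $i<j$. For $\upsilon\in\mathbf R^k$, $\theta\in\mathbf R^r$, $\alpha,\beta\in\mathbf R^s$, the system $\mathrm{Th}(P(\upsilon,y))^{\mu,\nu,\eta}(\theta,\alpha+i\beta)$ says that $$P(\upsilon,y)=\prod_j(y-\theta_j)^{\mu_j}\prod_k\big((y-\alpha_k)^2+\beta_k^2\big)^{\nu_k},$$ that the $\theta_j$ are pairwise distinct, all $\beta_k\neq0$, the quadratics $(y-\alpha_k)^2+\beta_k^2$ have pairwise nonzero resultants, and $\mathrm{sign}(P^{(h)}(\upsilon,\theta_j))=\eta_j(h)$ for all $j$ and $1\le h\le p-1$. *Claim.*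 Let $\tau$ and $\tau'$ be sign conditions on $\mathrm{ThElim}(P)$ and $\mathrm{ThElim}(P;Q)$ such that $\mathrm{Real}((\tau,\tau'),\mathbf R):=\mathrm{Real}(\tau,\mathbf R)\cap\mathrm{Real}(\tau',\mathbf R)\ne\emptyset$. Then there are unique root data $(\mu(\tau),\nu(\tau),\eta(\tau))$ of degree $p$ such that for every $\upsilon\in\mathrm{Real}(\tau,\mathbf R)$ there exist $\theta,\alpha,\beta$ with $\mathrm{Th}(P(\upsilon,y))^{\mu(\tau),\nu(\tau),\eta(\tau)}(\theta,\alpha+i\beta)$. Moreover there is a unique list of signs $\epsilon(\tau,\tau')=[\epsilon_1,\dots,\epsilon_r]\in\{-1,0,1\}^r$, $r=\#\mu(\tau)$, such that for every $\upsilon\in\mathrm{Real}((\tau,\tau'),\mathbf R)$ there exist $\theta\in\mathbf R^r$, $\alpha,\beta\in\mathbf R^{s}$, $s=\#\nu(\tau)$, with $$\mathrm{Th}(P(\upsilon,y))^{\mu(\tau),\nu(\tau),\eta(\tau)}(\theta,\alpha+i\beta)\quad\text{and}\quad \mathrm{sign}(Q(\upsilon,\theta_j))=\epsilon_j\ \text{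 for } 1\le j\le r.$$ -/

import Mathlib

open Polynomial

noncomputable section

/-! ### Hermite matrices and the elimination families -/

/-- The Hermite matrix `Her(P; Q)` of a monic polynomial `P` and a polynomial `Q` over a
commutative ring `A`: its `(i, j)` entry, `0 ≤ i, j < deg P`, is the trace of multiplication by
`Q * y ^ (i + j)` on the free `A`-module `A[y] / (P)`. -/
def hermiteMatrix {A : Type*} [CommRing A] (P Q : A[X]) :
    Matrix (Fin P.natDegree) (Fin P.natDegree) A :=
  Matrix.of fun i j =>
    Algebra.trace A (AdjoinRoot P) (AdjoinRoot.mk P (Q * X ^ ((i : ℕ) + (j : ℕ))))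

/-- `HMi(P; Q)`: the set of the leading principal minors of orders `1, …, deg P` of the
Hermite matrix `Her(P; Q)`. -/
def hermiteMinors {A : Type*} [CommRing A] (P Q : A[X]) : Set A :=
  {H | ∃ (r : ℕ) (hr : r ≤ P.natDegree), 1 ≤ r ∧
    H = ((hermiteMatrix P Q).submatrix (Fin.castLE hr) (Fin.castLE hr)).det}

/-- `PDer_i(P)`: products of powers, with exponents in `{0, 1, 2}`, of the derivatives
`P^(1), …, P^(p-1)` (`p = deg P`), with at most `i` nonzero exponents. -/
def PDer {A : Type*} [CommRing A] (i : ℕ) (P : A[X]) : Set A[X] :=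
  {B | ∃ a : ℕ → ℕ, (∀ h, a h ≤ 2) ∧
    ((Finset.Ico 1 P.natDegree).filter fun h => a h ≠ 0).card ≤ i ∧
    B = ∏ h ∈ Finset.Ico 1 P.natDegree, (derivative^[h] P) ^ a h}

/-- `PDer_i(P; Q)`: products of an element of `PDer_i(P)` with `Q` or `Q ^ 2`. -/
def PDerWith {A : Type*} [CommRing A] (i : ℕ) (P Q : A[X]) : Set A[X] :=
  {C | ∃ B ∈ PDer i P, C = B * Q ∨ C = B * Q ^ 2}

/-- `ThElim(P)`. Here `Nat.size p` is the number of binary digits of `p`. -/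
def ThElim {A : Type*} [CommRing A] (P : A[X]) : Set A :=
  ⋃ B ∈ PDer (Nat.size P.natDegree) P, hermiteMinors P B

/-- `ThElim(P; Q)`. -/
def ThElimWith {A : Type*} [CommRing A] (P Q : A[X]) : Set A :=
  ⋃ B ∈ PDerWith (Nat.size P.natDegree - 1) P Q, hermiteMinors P B

/-! ### Sign conditions on families of polynomials in the parameters -/

/-- The realization in `R ^ k` of a sign condition `τ ∈ {-1, 0, 1} ^ S` on a set `S` of
polynomials in the parameters `u₁, …, u_k`. -/
def signRealization {k : ℕ} {K : Type*} [Field K] (R : Type*) [Field R] [LinearOrder R]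
    [Algebra K R] {S : Set (MvPolynomial (Fin k) K)} (τ : S → SignType) : Set (Fin k → R) :=
  {υ | ∀ H : S, SignType.sign (MvPolynomial.aeval υ (H : MvPolynomial (Fin k) K)) = τ H}

/-- The specialization `P(υ, y) ∈ R[y]` of `P ∈ K[u][y]` at a parameter point `υ ∈ R ^ k`. -/
def specialize {k : ℕ} {K : Type*} [Field K] {R : Type*} [Field R] [Algebra K R]
    (P : (MvPolynomial (Fin k) K)[X]) (υ : Fin k → R) : R[X] :=
  P.map (MvPolynomial.aeval υ : MvPolynomial (Fin k) K →ₐ[K] R).toRingHom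

/-! ### Sign conditions on the derivatives of a monic polynomial of degree `p` -/

/-- Sign conditions on `Der(P) = P', …, P^(p-1)`, where `p = deg P`. -/
abbrev DerSign (p : ℕ) : Type := Finset.Ico 1 p → SignType

/-- The extension `η₊` of a sign condition `η` on `Der(P)` to `{0, …, p}`, for `P` monic of
degree `p ≥ 1`: `η₊(0) = 0`, and `η₊(p) = 1` is the sign of the leading coefficient.
(Values beyond `p` are irrelevant.) -/
def DerSign.plus {p : ℕ} (η : DerSign p) (h : ℕ) : SignType :=
  if hh : h ∈ Finset.Ico 1 p then η ⟨h, hh⟩ else if h = p then 1 else 0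

/-- The multiplicity `mu(η, P)`: the smallest `i`, `0 ≤ i ≤ p`, with `η₊(i) ≠ 0`. -/
def DerSign.mu {p : ℕ} (η : DerSign p) : ℕ :=
  sInf {i | η.plus i ≠ 0}

/-- `η₁₊ ≺_P η₂₊` : at the biggest index `q` with `η₁₊(q) ≠ η₂₊(q)`, either
`η₁₊(q) < η₂₊(q)` and `η₁₊(q + 1) = 1`, or `η₁₊(q) > η₂₊(q)` and `η₁₊(q + 1) = -1`. -/
def DerSign.Prec {p : ℕ} (η₁ η₂ : DerSign p) : Prop :=
  ∃ q < p, η₁.plus q ≠ η₂.plus q ∧ (∀ h, q < h → h < p → η₁.plus h = η₂.plus h) ∧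
    ((η₁.plus q < η₂.plus q ∧ η₁.plus (q + 1) = 1) ∨
      (η₂.plus q < η₁.plus q ∧ η₁.plus (q + 1) = -1))

/-- The order `≺_P^mu` on sign conditions on `Der(P)`. -/
def DerSign.MuPrec {p : ℕ} (η₁ η₂ : DerSign p) : Prop :=
  η₂.mu < η₁.mu ∨ (η₁.mu = η₂.mu ∧ η₁.Prec η₂)

/-! ### The factorization and Thom systems -/

/-- A triple `(μ, ν, η)` as follows: `(μ, ν) ∈ Λ_m × Λ_n` with `m + 2 n = p`, where `Λ_m` is the
set of non-increasing lists of positive integers with sum `m`, and `η` is a list, with as many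
elements as `μ`, of distinct sign conditions on `Der(P)` ordered with respect to `≺_P^mu`.
A list is given by its length and its entries; `r` is the common length of `μ` and `η`, and `s` is
the length of `ν`. -/
structure ThomData (p : ℕ) where
  r : ℕ
  s : ℕ
  mult : Fin r → ℕ
  cmult : Fin s → ℕ
  enc : Fin r → DerSign p
  mult_pos : ∀ j, 0 < mult j
  mult_antitone : Antitone mult
  cmult_pos : ∀ k, 0 < cmult k
  cmult_antitone : Antitone cmult
  sum_eq : ∑ j, mult j + 2 * ∑ k, cmult k = p
  enc_injective : Function.Injective enc
  enc_ordered : ∀ i j, i < j → (enc i).MuPrec (enc j)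

/-- The resultant of `(y - a)² + b²` and `(y - a')² + b'²`; for `z = a + ib`, `z' = a' + ib'` it is
`(z - z')(z - z̄')(z̄ - z')(z̄ - z̄')`. -/
def quadRes {R : Type*} [CommRing R] (a b a' b' : R) : R :=
  ((a - a') ^ 2 + (b - b') ^ 2) * ((a - a') ^ 2 + (b + b') ^ 2)

/-- The system `Fact(P)^{μ, ν}(θ, α + iβ)` describing the decomposition of `P ∈ R[y]` into
irreducible real factors. -/
structure IsFact {R : Type*} [Field R] (P : R[X]) {r s : ℕ} (μ : Fin r → ℕ) (ν : Fin s → ℕ)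
    (θ : Fin r → R) (α β : Fin s → R) : Prop where
  eq_prod : P = (∏ j, (X - C (θ j)) ^ μ j) *
    ∏ k, ((X - C (α k)) ^ 2 + C (β k) ^ 2) ^ ν k
  real_ne : ∀ i j, i < j → θ i ≠ θ j
  im_ne : ∀ k, β k ≠ 0
  res_ne : ∀ k l, k < l → quadRes (α k) (β k) (α l) (β l) ≠ 0

/-- The system `Th(P)^{μ, ν, η}(θ, α + iβ)`: the factorization system together with
`sign(P^(h)(θ_j)) = η_j(h)` for all `j` and `1 ≤ h ≤ p - 1`. -/
structure IsThom {R : Type*} [Field R] [LinearOrder R] {p : ℕ} (P : R[X]) (D : ThomData p)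
    (θ : Fin D.r → R) (α β : Fin D.s → R) : Prop where
  fact : IsFact P D.mult D.cmult θ α β
  sign_eq : ∀ (j : Fin D.r) (h : Finset.Ico 1 p),
    SignType.sign ((derivative^[(h : ℕ)] P).eval (θ j)) = D.enc j h

/-- The triple `D = (μ, ν, η)` describes the real roots, with their Thom encodings, and the complex
roots of `P(υ, y)` at every point `υ` of the realization of the sign condition `τ` on `ThElim(P)`. -/
def FixesThom {k : ℕ} {K : Type*} [Field K] (R : Type*) [Field R] [LinearOrder R] [Algebra K R]
    {p : ℕ} (P : (MvPolynomial (Fin k) K)[X]) (τ : ThElim P → SignType) (D : ThomData p) : Prop :=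
  ∀ υ ∈ signRealization R τ, ∃ (θ : Fin D.r → R) (α β : Fin D.s → R),
    IsThom (specialize P υ) D θ α β

end

/-! ### The fundamental theorem of algebra over a real closed field -/

section FundamentalTheorem

/-! Fix a point `υ` and a polynomial `A`. The Hermite matrix of `P(υ, y)` and `A` is the Gram matrix
of `f ↦ Tr (A f²)`. Over `R(i)` the trace is a weighted sum of evaluations at the roots of `P`.
Hence the rank is the number of complex roots where `A ≠ 0`, and the signature is the Tarski query,
the sum of `sign A(x)` over the distinct real roots `x` (Hermite, `hermite_signature`). The matrix
is Hankel, so the signs of its leading principal minors determine rank and signature even when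
intermediate minors vanish (Frobenius, `signature_eq_of_sign_hankelDet_eq`). Both numbers are
therefore constant on the realization of a sign condition on the minors.

For `A` a product of powers of derivatives, the Tarski query is a moment of the family of sign
vectors `(sign P^(h)(x))_h` over the real roots, and the rank is a moment of the 0/1 vanishing
patterns over the complex roots. Moments involving few coordinates suffice: a nonzero integer
function on sign vectors whose moments in at most `ℓ` coordinates vanish has at least `2 ^ (ℓ + 1)`
points in its support (`two_pow_le_card_support`). The difference of two counting functions of at
most `p` points each is supported on at most `2p < 2 ^ (bit p + 1)` points, so `ℓ = bit p` makes it
zero (`card_filter_eq_of_moments`).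

So the number of real roots with a given encoding and the number of complex roots with a given
vanishing pattern are constant. The latter gives the complex multiplicities, and these counts
recover the root data (`IsThom.thomData_eq`). For `Q`, its sign is added as one more coordinate.
When it occurs in a moment it uses one of the `bit p` places, which leaves `bit p - 1` for the
derivatives. By Thom's lemma (`thomEncoding_prec`) an encoding belongs to at most one real root, so
the sign of `Q` at that root is fixed as well.

The analysis needed over a real closed field (intermediate values, Rolle, mean value) comes from
factoring over the algebraically closed field `R(i)`. -/

theorem Polynomial.natDegree_eq_one_of_irreducible_of_odd {F : Type*} [Field F]
    (h : ∀ f : F[X], Odd f.natDegree → ∃ x, f.IsRoot x) {f : F[X]} (hf : Irreducible f)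
    (hodd : Odd f.natDegree) : f.natDegree = 1 := by
  obtain ⟨x, hx⟩ := h f hodd
  exact natDegree_eq_of_degree_eq_some (degree_eq_one_of_irreducible_of_root hf hx)

theorem finrank_eq_one_of_odd {F E : Type*} [Field F] [CharZero F] [Field E] [Algebra F E]
    [FiniteDimensional F E] (h : ∀ f : F[X], Odd f.natDegree → ∃ x, f.IsRoot x)
    (hodd : Odd (Module.finrank F E)) : Module.finrank F E = 1 := by
  obtain ⟨α, hα⟩ := Field.exists_primitive_element F E
  have hint : IsIntegral F α := Algebra.IsIntegral.isIntegral α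
  have hdeg : (minpoly F α).natDegree = Module.finrank F E := by
    rw [← IntermediateField.adjoin.finrank hint, hα, IntermediateField.finrank_top']
  rw [← hdeg] at hodd ⊢
  exact natDegree_eq_one_of_irreducible_of_odd h (minpoly.irreducible hint) hodd

/-- The fixed field of a Sylow 2-subgroup has odd degree over `F`, hence equals `F`, so the whole
Galois group is a 2-group. -/
theorem IsGalois.exists_finrank_eq_two_pow {F E : Type*} [Field F] [CharZero F] [Field E]
    [Algebra F E] [FiniteDimensional F E] [IsGalois F E]
    (h : ∀ f : F[X], Odd f.natDegree → ∃ x, f.IsRoot x) :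
    ∃ n, Module.finrank F E = 2 ^ n := by
  have : Fact (Nat.Prime 2) := ⟨Nat.prime_two⟩
  let S : Sylow 2 Gal(E/F) := default
  have hodd : Odd (Module.finrank F (IntermediateField.fixedField (S : Subgroup Gal(E/F)))) := by
    rw [IntermediateField.finrank_eq_fixingSubgroup_index,
      IntermediateField.fixingSubgroup_fixedField, ← Nat.not_even_iff_odd, even_iff_two_dvd]
    exact S.not_dvd_index
  have h1 := finrank_eq_one_of_odd h hodd
  obtain ⟨n, hn⟩ := IsPGroup.iff_card.mp S.isPGroup'
  refine ⟨n, ?_⟩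
  rw [← Module.finrank_mul_finrank F (IntermediateField.fixedField (S : Subgroup Gal(E/F))) E, h1,
    IntermediateField.finrank_fixedField_eq_card, one_mul, ← hn]

theorem finrank_ne_two_of_isSquare {F E : Type*} [Field F] [CharZero F] [Field E]
    [Algebra F E] (hsq : ∀ x : F, IsSquare x) : Module.finrank F E ≠ 2 := by
  intro h2
  have : FiniteDimensional F E := Module.finite_of_finrank_pos (by omega)
  obtain ⟨α, hα⟩ := Field.exists_primitive_element F E
  have hint : IsIntegral F α := Algebra.IsIntegral.isIntegral α
  have hdeg : (minpoly F α).natDegree = 2 := by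
    rw [← h2, ← IntermediateField.adjoin.finrank hint, hα, IntermediateField.finrank_top']
  set f := minpoly F α with hf
  have hirr : Irreducible f := minpoly.irreducible hint
  obtain ⟨x, hx⟩ := exists_quadratic_eq_zero (a := (1 : F)) (b := f.coeff 1) (c := f.coeff 0)
    one_ne_zero (hsq _)
  have hlead : f.coeff 2 = 1 := by
    have := (minpoly.monic hint).coeff_natDegree
    rwa [← hf, hdeg] at this
  have hroot : f.IsRoot x := by
    rw [IsRoot, eval_eq_sum_range, hdeg]
    simp only [Finset.sum_range_succ, Finset.sum_range_zero, hlead]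
    linear_combination hx
  have h1 : f.natDegree = 1 :=
    natDegree_eq_of_degree_eq_some (degree_eq_one_of_irreducible_of_root hirr hroot)
  omega

/-- A group of order `2 ^ (n + 1)` has a subgroup of index 2. Its fixed field would be a quadratic
extension, which the quadratic formula excludes when every element is a square. -/
theorem IsGalois.finrank_eq_one_of_two_pow {F E : Type*} [Field F] [CharZero F] [Field E]
    [Algebra F E] [FiniteDimensional F E] [IsGalois F E] (hsq : ∀ x : F, IsSquare x) {n : ℕ}
    (hn : Module.finrank F E = 2 ^ n) : Module.finrank F E = 1 := by
  have : Fact (Nat.Prime 2) := ⟨Nat.prime_two⟩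
  rcases n with _ | n
  · simpa using hn
  exfalso
  obtain ⟨H, hH⟩ := Sylow.exists_subgroup_card_pow_prime (G := Gal(E/F)) 2 (n := n) (by
    rw [IsGalois.card_aut_eq_finrank, hn, pow_succ]; exact dvd_mul_right _ _)
  have hmul := Module.finrank_mul_finrank F (IntermediateField.fixedField H) E
  rw [IntermediateField.finrank_fixedField_eq_card, hH, hn, pow_succ, mul_comm] at hmul
  exact finrank_ne_two_of_isSquare (E := IntermediateField.fixedField H) hsq
    (Nat.eq_of_mul_eq_mul_left (by positivity) hmul)

/-- A finite extension, all of whose elements are squares, of a field of characteristic zero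
in which polynomials of odd degree have roots, is algebraically closed. -/
theorem isAlgClosed_of_odd_of_isSquare {F E : Type*} [Field F] [CharZero F] [Field E]
    [Algebra F E] [FiniteDimensional F E]
    (h : ∀ f : F[X], Odd f.natDegree → ∃ x, f.IsRoot x) (hsq : ∀ x : E, IsSquare x) :
    IsAlgClosed E := by
  have : CharZero E := charZero_of_injective_algebraMap (algebraMap F E).injective
  refine IsAlgClosed.of_exists_root _ fun f _ hirr => ?_
  have : Fact (Irreducible f) := ⟨hirr⟩
  let A := AdjoinRoot f
  have : FiniteDimensional E A := (AdjoinRoot.powerBasis hirr.ne_zero).finite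
  have : FiniteDimensional F A := FiniteDimensional.trans F E A
  -- The normal closure is taken over `F`, not over `E`: the Sylow argument needs `N/F` Galois, and
  -- `N/E` is then Galois too, of degree dividing a power of 2.
  let N := IntermediateField.normalClosure F A (AlgebraicClosure A)
  let _ : Algebra E N := ((algebraMap A N).comp (algebraMap E A)).toAlgebra
  have : IsScalarTower E A N := IsScalarTower.of_algebraMap_eq fun _ => rfl
  have : IsScalarTower F E N := IsScalarTower.of_algebraMap_eq fun x => by
    rw [IsScalarTower.algebraMap_apply E A N, ← IsScalarTower.algebraMap_apply F E A,
      ← IsScalarTower.algebraMap_apply F A N]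
  have : Normal F (AlgebraicClosure A) := inferInstance
  have : IsGalois F N := inferInstance
  have : IsGalois E N := IsGalois.tower_top_of_isGalois F E N
  have : FiniteDimensional E N := FiniteDimensional.right F E N
  obtain ⟨n, hn⟩ := IsGalois.exists_finrank_eq_two_pow (E := N) h
  have hmul := Module.finrank_mul_finrank F E N
  obtain ⟨m, -, hm⟩ := (Nat.dvd_prime_pow Nat.prime_two).1 (hn ▸ hmul ▸ dvd_mul_left _ _)
  have h1 := IsGalois.finrank_eq_one_of_two_pow hsq hm
  have hmul' := Module.finrank_mul_finrank E A N
  have hA : Module.finrank E A = 1 := Nat.eq_one_of_mul_eq_one_right (hmul'.trans h1)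
  obtain ⟨x, hx⟩ := (Algebra.finrank_eq_one_iff_bijective_algebraMap.1 hA).2 (AdjoinRoot.root f)
  refine ⟨x, ?_⟩
  apply (algebraMap E A).injective
  rw [← eval₂_at_apply, map_zero, hx]
  exact AdjoinRoot.eval₂_root f

end FundamentalTheorem

/-- The field `R(i)`. -/
abbrev Cx (R : Type*) [Field R] : Type _ := QuadraticAlgebra R (-1) 0

section RealClosed

variable {R : Type*} [Field R] [LinearOrder R] [IsStrictOrderedRing R]

/-- That `-1` is not a square is what makes `R(i)` a field. -/
instance Cx.fact : Fact (∀ r : R, r ^ 2 ≠ -1 + 0 * r) :=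
  ⟨fun r h => by nlinarith [sq_nonneg r]⟩

/-- With `s = |z|`, a square root is `a ± ib` where `a² = (s + re z) / 2` and `b² = (s - re z) / 2`.
Then `2ab = ± im z`, and the sign of `b` is chosen accordingly. -/
theorem Cx.isSquare [IsRealClosed R] (z : Cx R) : IsSquare z := by
  obtain ⟨s, hs⟩ := IsSquare.of_nonneg (add_nonneg (mul_self_nonneg z.re) (mul_self_nonneg z.im))
  wlog hs0 : 0 ≤ s generalizing s
  · exact this (-s) (by rw [hs]; ring) (by linarith)
  have h1 : |z.re| ≤ s := abs_le_of_sq_le_sq (by nlinarith [mul_self_nonneg z.im]) hs0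
  obtain ⟨a, ha⟩ := IsSquare.of_nonneg (show 0 ≤ (s + z.re) / 2 by linarith [neg_abs_le z.re])
  obtain ⟨b, hb⟩ := IsSquare.of_nonneg (show 0 ≤ (s - z.re) / 2 by linarith [le_abs_self z.re])
  have hab : (2 * (a * b)) ^ 2 = z.im ^ 2 := by
    have : (a * a) * (b * b) = (s + z.re) / 2 * ((s - z.re) / 2) := by rw [← ha, ← hb]
    linear_combination 4 * this - hs
  rcases sq_eq_sq_iff_eq_or_eq_neg.1 hab with h | h
  · refine ⟨⟨a, b⟩, ?_⟩
    ext <;> simp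
    · linear_combination ha - hb
    · linear_combination -h
  · refine ⟨⟨a, -b⟩, ?_⟩
    ext <;> simp
    · linear_combination ha - hb
    · linear_combination h

instance Cx.isAlgClosed [IsRealClosed R] : IsAlgClosed (Cx R) :=
  isAlgClosed_of_odd_of_isSquare (F := R)
    (fun _ hf => IsRealClosed.exists_isRoot_of_odd_natDegree hf) Cx.isSquare

end RealClosed

/-! ### Polynomials over a real closed field: intermediate values, Rolle, Thom's lemma -/

section Quadratic

variable {R : Type*} [Field R]

theorem quadFactor_monic (α β : R) : ((X - C α) ^ 2 + C β ^ 2 : R[X]).Monic := by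
  have : ((X - C α) ^ 2 + C β ^ 2 : R[X]) = X ^ 2 + C (-2 * α) * X + C (α ^ 2 + β ^ 2) := by
    simp only [C_mul, C_add, C_neg, C_pow, C_ofNat]; ring
  rw [this]
  monicity!

theorem quadFactor_natDegree (α β : R) : ((X - C α) ^ 2 + C β ^ 2 : R[X]).natDegree = 2 := by
  have : ((X - C α) ^ 2 + C β ^ 2 : R[X]) = X ^ 2 + C (-2 * α) * X + C (α ^ 2 + β ^ 2) := by
    simp only [C_mul, C_add, C_neg, C_pow, C_ofNat]; ring
  rw [this]
  compute_degree!

theorem quadFactor_map (z : Cx R) :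
    ((X - C z.re) ^ 2 + C z.im ^ 2 : R[X]).map (algebraMap R (Cx R)) =
      (X - C z) * (X - C (star z)) := by
  have h1 : algebraMap R (Cx R) z.re + algebraMap R (Cx R) z.re = z + star z := by
    ext <;> simp
  have h2 : algebraMap R (Cx R) z.re ^ 2 + algebraMap R (Cx R) z.im ^ 2 = z * star z := by
    ext <;> simp [pow_two]
    ring
  have h1' := congrArg (C : Cx R → (Cx R)[X]) h1
  have h2' := congrArg (C : Cx R → (Cx R)[X]) h2
  simp only [C_add, C_mul, C_pow] at h1' h2'
  simp only [Polynomial.map_add, Polynomial.map_pow, Polynomial.map_sub, map_X, map_C]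
  linear_combination (-X) * h1' + h2'

end Quadratic

section RealClosed

variable {R : Type*} [Field R] [LinearOrder R] [IsStrictOrderedRing R]

/-- The remainder `uX + v` of `f` modulo the quadratic vanishes at `z`. Its imaginary part `u · im
z` forces `u = 0`, and then `v = 0`. -/
theorem quadFactor_dvd {f : R[X]} {z : Cx R} (hz : (f.map (algebraMap R (Cx R))).IsRoot z)
    (him : z.im ≠ 0) : ((X - C z.re) ^ 2 + C z.im ^ 2 : R[X]) ∣ f := by
  set q : R[X] := (X - C z.re) ^ 2 + C z.im ^ 2 with hq
  have hqm : q.Monic := quadFactor_monic _ _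
  rw [← modByMonic_eq_zero_iff_dvd hqm]
  have hdeg : (f %ₘ q).degree ≤ 1 := by
    have h := degree_modByMonic_lt f hqm
    rw [degree_eq_natDegree hqm.ne_zero, quadFactor_natDegree] at h
    exact Order.le_of_lt_succ h
  have hform := eq_X_add_C_of_degree_le_one hdeg
  set u := (f %ₘ q).coeff 1
  set v := (f %ₘ q).coeff 0
  have hqz : (q.map (algebraMap R (Cx R))).eval z = 0 := by
    rw [hq, quadFactor_map]; simp
  have h0 : ((f %ₘ q).map (algebraMap R (Cx R))).eval z = 0 := by
    have h := congrArg (fun g => (g.map (algebraMap R (Cx R))).eval z) (modByMonic_add_div f q)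
    simpa [hqz, hz.eq_zero] using h
  rw [hform] at h0
  have hre := congrArg QuadraticAlgebra.re h0
  have hi := congrArg QuadraticAlgebra.im h0
  simp at hre hi
  have hu : u = 0 := hi.resolve_right him
  rw [hu] at hre
  rw [hform, hu]
  simpa using hre

variable [IsRealClosed R]

theorem Polynomial.exists_factor_of_natDegree_pos {f : R[X]} (hf : 0 < f.natDegree) :
    (∃ a g, f = (X - C a) * g) ∨
      ∃ a b g, b ≠ 0 ∧ f = ((X - C a) ^ 2 + C b ^ 2) * g := by
  obtain ⟨z, hz⟩ := IsAlgClosed.exists_root (f.map (algebraMap R (Cx R))) (by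
    rw [degree_map]; exact (natDegree_pos_iff_degree_pos.1 hf).ne')
  by_cases him : z.im = 0
  · left
    have hz' : z = algebraMap R (Cx R) z.re := by ext <;> simp [him]
    rw [hz', IsRoot, eval_map_algebraMap, aeval_algebraMap_apply,
      (algebraMap R (Cx R)).injective.eq_iff' (map_zero _)] at hz
    obtain ⟨g, hg⟩ := dvd_iff_isRoot.2 (show f.IsRoot z.re from by simpa using hz)
    exact ⟨_, g, hg⟩
  · right
    obtain ⟨g, hg⟩ := quadFactor_dvd hz him
    exact ⟨_, _, g, him, hg⟩

/-- Induction on the degree by stripping a real factor. A quadratic factor is positive everywhere,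
and a linear factor whose root is outside `(a, b)` has the same sign at both ends, so the cofactor
still changes sign. -/
theorem Polynomial.exists_root_of_mul_neg (f : R[X]) {a b : R} (hab : a < b)
    (h : f.eval a * f.eval b < 0) : ∃ c, a < c ∧ c < b ∧ f.eval c = 0 := by
  induction hn : f.natDegree using Nat.strong_induction_on generalizing f with
  | _ n ih =>
    have hf0 : f ≠ 0 := by rintro rfl; simp at h
    rcases Nat.eq_zero_or_pos f.natDegree with h0 | hpos
    · rw [eq_C_of_natDegree_eq_zero h0] at h
      simp only [eval_C] at h
      exact absurd h (mul_self_nonneg _).not_gt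
    rcases exists_factor_of_natDegree_pos hpos with ⟨c, g, rfl⟩ | ⟨c, d, g, hd, rfl⟩
    · have hg0 : g ≠ 0 := right_ne_zero_of_mul hf0
      by_cases hc : a < c ∧ c < b
      · exact ⟨c, hc.1, hc.2, by simp⟩
      have hpos : 0 < (a - c) * (b - c) := by
        simp only [eval_mul, eval_sub, eval_X, eval_C] at h
        have h1 : a - c ≠ 0 := by rintro h1; simp [h1] at h
        have h2 : b - c ≠ 0 := by rintro h2; simp [h2] at h
        rcases lt_or_gt_of_ne h1 with h1 | h1
        · have : ¬ c < b := fun hcb => hc ⟨by linarith, hcb⟩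
          exact mul_pos_of_neg_of_neg h1 (lt_of_le_of_ne (by linarith) h2)
        · exact mul_pos h1 (by linarith)
      obtain ⟨x, h1, h2, h3⟩ := ih g.natDegree (by
        rw [← hn, natDegree_mul (X_sub_C_ne_zero c) hg0, natDegree_X_sub_C]; omega) g (by
          simp only [eval_mul, eval_sub, eval_X, eval_C] at h
          by_contra hcon
          nlinarith) rfl
      exact ⟨x, h1, h2, by simp [h3]⟩
    · have hg0 : g ≠ 0 := right_ne_zero_of_mul hf0
      have hd2 : 0 < d ^ 2 := by positivity
      have hpos : 0 < ((a - c) ^ 2 + d ^ 2) * ((b - c) ^ 2 + d ^ 2) := by positivity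
      obtain ⟨x, h1, h2, h3⟩ := ih g.natDegree (by
        rw [← hn, natDegree_mul (quadFactor_monic c d).ne_zero hg0, quadFactor_natDegree]
        omega) g (by
          simp only [eval_mul, eval_add, eval_pow, eval_sub, eval_X, eval_C] at h
          by_contra hcon
          nlinarith) rfl
      exact ⟨x, h1, h2, by simp [h3]⟩

theorem Polynomial.eval_mul_eval_pos_of_forall_ne (f : R[X]) {a b : R} (hab : a ≤ b)
    (h : ∀ c, a ≤ c → c ≤ b → f.eval c ≠ 0) : 0 < f.eval a * f.eval b := by
  rcases hab.eq_or_lt with rfl | hlt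
  · exact mul_self_pos.2 (h a le_rfl le_rfl)
  by_contra hcon
  obtain ⟨c, h1, h2, h3⟩ := f.exists_root_of_mul_neg hlt (lt_of_le_of_ne (not_lt.1 hcon)
    (mul_ne_zero (h a le_rfl hab) (h b hab le_rfl)))
  exact h c h1.le h2.le h3

/-- Rolle's theorem for consecutive roots. -/
theorem Polynomial.exists_derivative_root_of_consecutive {f : R[X]} (hf : f ≠ 0) {a b : R}
    (hab : a < b) (ha : f.eval a = 0) (hb : f.eval b = 0)
    (hne : ∀ c, a < c → c < b → f.eval c ≠ 0) :
    ∃ c, a < c ∧ c < b ∧ f.derivative.eval c = 0 := by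
  obtain ⟨f₁, hf₁, hna⟩ := exists_eq_pow_rootMultiplicity_mul_and_not_dvd f hf a
  have hm : 0 < f.rootMultiplicity a := (rootMultiplicity_pos hf).2 ha
  obtain ⟨m, hm'⟩ := Nat.exists_eq_succ_of_ne_zero hm.ne'
  rw [hm'] at hf₁
  have hf₁0 : f₁ ≠ 0 := by rintro rfl; simp at hna
  have hb₁ : f₁.eval b = 0 := by
    rw [hf₁] at hb
    simpa [sub_eq_zero, hab.ne'] using hb
  obtain ⟨g, hg, hnb⟩ := exists_eq_pow_rootMultiplicity_mul_and_not_dvd f₁ hf₁0 b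
  have hn : 0 < f₁.rootMultiplicity b := (rootMultiplicity_pos hf₁0).2 hb₁
  obtain ⟨n, hn'⟩ := Nat.exists_eq_succ_of_ne_zero hn.ne'
  rw [hn'] at hg
  have hga : g.eval a ≠ 0 := by
    intro h
    apply hna
    rw [hg]
    exact Dvd.dvd.mul_left (dvd_iff_isRoot.2 h) _
  have hgb : g.eval b ≠ 0 := fun h => hnb (dvd_iff_isRoot.2 h)
  have hfe : f = (X - C a) ^ (m + 1) * ((X - C b) ^ (n + 1) * g) := by rw [← hg]; exact hf₁
  have hpos : 0 < g.eval a * g.eval b := by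
    refine g.eval_mul_eval_pos_of_forall_ne hab.le fun c hac hcb h => ?_
    rcases hac.eq_or_lt with rfl | hac
    · exact hga h
    rcases hcb.eq_or_lt with rfl | hcb
    · exact hgb h
    exact hne c hac hcb (by rw [hfe]; simp [h])
  -- `f' = (X - a)^m (X - b)^n k`, and `k(a) k(b) = -(m+1)(n+1)(b-a)² g(a) g(b)` is negative because
  -- `g` has no root in `[a, b]`.
  let k : R[X] := C ((m : R) + 1) * (X - C b) * g + C ((n : R) + 1) * (X - C a) * g +
    (X - C a) * (X - C b) * derivative g
  have hk : derivative f = (X - C a) ^ m * (X - C b) ^ n * k := by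
    rw [hfe]
    simp only [k, derivative_mul, derivative_pow, derivative_sub, derivative_X, derivative_C,
      Nat.add_sub_cancel, Nat.cast_add, Nat.cast_one, C_add, C_1, map_natCast]
    ring
  obtain ⟨c, h1, h2, h3⟩ := k.exists_root_of_mul_neg hab (by
    have hd : 0 < ((m : R) + 1) * ((n : R) + 1) * (b - a) ^ 2 := by
      have : 0 < b - a := sub_pos.2 hab
      positivity
    simp only [k, eval_add, eval_mul, eval_sub, eval_X, eval_C, sub_self, mul_zero, zero_mul,
      add_zero, zero_add]
    nlinarith [mul_pos hd hpos])
  exact ⟨c, h1, h2, by rw [hk]; simp [h3]⟩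

theorem Polynomial.exists_derivative_root (f : R[X]) {a b : R} (hab : a < b)
    (ha : f.eval a = 0) (hb : f.eval b = 0) :
    ∃ c, a < c ∧ c < b ∧ f.derivative.eval c = 0 := by
  classical
  by_cases hf : f = 0
  · exact ⟨(a + b) / 2, by linarith, by linarith, by simp [hf]⟩
  -- Roots may lie between `a` and `b`; the smallest root beyond `a` is consecutive to it.
  let S := f.roots.toFinset.filter (a < ·)
  have hS : S.Nonempty := ⟨b, by simp [S, hf, hb, hab]⟩
  have hmem := S.min'_mem hS
  simp only [S, Finset.mem_filter, Multiset.mem_toFinset, mem_roots hf, IsRoot] at hmem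
  obtain ⟨c, h1, h2, h3⟩ := exists_derivative_root_of_consecutive hf hmem.2 ha hmem.1
    fun c hac hcb hc => by
      have := S.min'_le c (by simp [S, hf, hc, hac])
      exact absurd hcb this.not_gt
  exact ⟨c, h1, h2.trans_le (S.min'_le b (by simp [S, hf, hb, hab])), h3⟩

/-- The mean value theorem for polynomials over a real closed field. -/
theorem Polynomial.exists_derivative_eq_slope (f : R[X]) {a b : R} (hab : a < b) :
    ∃ c, a < c ∧ c < b ∧ f.eval b - f.eval a = f.derivative.eval c * (b - a) := by
  let s := (f.eval b - f.eval a) / (b - a)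
  have hba : b - a ≠ 0 := (sub_pos.2 hab).ne'
  have hs : s * (b - a) = f.eval b - f.eval a := div_mul_cancel₀ _ hba
  obtain ⟨c, h1, h2, h3⟩ := (f - C (f.eval a) - C s * (X - C a)).exists_derivative_root hab
    (by simp) (by simp [hs])
  refine ⟨c, h1, h2, ?_⟩
  simp [sub_eq_zero] at h3
  rw [h3, hs]

/-- If the signs of `f` at `x < y` agree and `f'` has a constant nonzero sign on `[x, y]`,
then `f` has a constant nonzero sign on `[x, y]`. -/
theorem Polynomial.sign_eq_of_sign_derivative {f : R[X]} {x y : R} (hxy : x < y) {s : SignType}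
    (hs : s ≠ 0) (hd : ∀ c, x ≤ c → c ≤ y → SignType.sign (f.derivative.eval c) = s)
    (he : SignType.sign (f.eval x) = SignType.sign (f.eval y)) :
    SignType.sign (f.eval x) ≠ 0 ∧
      ∀ c, x ≤ c → c ≤ y → SignType.sign (f.eval c) = SignType.sign (f.eval x) := by
  -- By the mean value theorem `f` is strictly monotone on `[x, y]`, in the direction given by `s`.
  -- Hence intermediate values lie between the end values, which have the same sign and cannot both
  -- be zero.
  have mono : ∀ a b, x ≤ a → a < b → b ≤ y →
      (s = 1 → f.eval a < f.eval b) ∧ (s = -1 → f.eval b < f.eval a) := by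
    intro a b hxa hab hby
    obtain ⟨c, h1, h2, h3⟩ := f.exists_derivative_eq_slope hab
    have hc := hd c (hxa.trans h1.le) (h2.le.trans hby)
    have hba := sub_pos.2 hab
    constructor <;> rintro rfl
    · have := mul_pos (sign_eq_one_iff.1 hc) hba
      linarith
    · have := mul_neg_of_neg_of_pos (sign_eq_neg_one_iff.1 hc) hba
      linarith
  have hlt := mono x y le_rfl hxy le_rfl
  have hs' : s = 1 ∨ s = -1 := by cases s <;> simp_all
  have key : ∀ c, x ≤ c → c ≤ y → (f.eval x ≤ f.eval c ∧ f.eval c ≤ f.eval y) ∨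
      (f.eval y ≤ f.eval c ∧ f.eval c ≤ f.eval x) := by
    intro c hxc hcy
    rcases hxc.eq_or_lt with rfl | hxc <;> rcases hcy.eq_or_lt with rfl | hcy
    · exact absurd hxy (lt_irrefl _)
    · have := mono x y le_rfl hxy le_rfl
      rcases hs' with h | h
      · exact Or.inl ⟨le_rfl, (this.1 h).le⟩
      · exact Or.inr ⟨(this.2 h).le, le_rfl⟩
    · have := mono x c le_rfl hxy le_rfl
      rcases hs' with h | h
      · exact Or.inl ⟨(this.1 h).le, le_rfl⟩
      · exact Or.inr ⟨le_rfl, (this.2 h).le⟩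
    · have h1 := mono x c le_rfl hxc hcy.le
      have h2 := mono c y hxc.le hcy le_rfl
      rcases hs' with h | h
      · exact Or.inl ⟨(h1.1 h).le, (h2.1 h).le⟩
      · exact Or.inr ⟨(h2.2 h).le, (h1.2 h).le⟩
  rcases lt_trichotomy (f.eval x) 0 with h0 | h0 | h0
  · have hy : f.eval y < 0 := by rwa [sign_neg h0, eq_comm, sign_eq_neg_one_iff] at he
    refine ⟨by simp [sign_neg h0], fun c h1 h2 => ?_⟩
    rw [sign_neg h0, sign_eq_neg_one_iff]
    rcases key c h1 h2 with h | h <;> linarith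
  · have hy : f.eval y = 0 := by rwa [h0, sign_zero, eq_comm, sign_eq_zero_iff] at he
    rcases hs' with h | h
    · have := hlt.1 h; linarith
    · have := hlt.2 h; linarith
  · have hy : 0 < f.eval y := by rwa [sign_pos h0, eq_comm, sign_eq_one_iff] at he
    refine ⟨by simp [sign_pos h0], fun c h1 h2 => ?_⟩
    rw [sign_pos h0, sign_eq_one_iff]
    rcases key c h1 h2 with h | h <;> linarith

end RealClosed

/-! ### Thom encodings -/

section Thom

/-- The signs of the derivatives `f', …, f^(p-1)` at a point. -/
noncomputable def thomEncoding {R : Type*} [Field R] [LinearOrder R] (p : ℕ) (f : R[X]) (x : R) : DerSign p :=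
  fun h => SignType.sign ((derivative^[(h : ℕ)] f).eval x)

theorem DerSign.plus_of_mem {p : ℕ} (η : DerSign p) {h : ℕ} (hh : h ∈ Finset.Ico 1 p) :
    η.plus h = η ⟨h, hh⟩ := by
  simp [DerSign.plus, hh]

theorem DerSign.plus_self {p : ℕ} (η : DerSign p) : η.plus p = 1 := by
  simp [DerSign.plus]

theorem DerSign.plus_zero {p : ℕ} (hp : 1 ≤ p) (η : DerSign p) : η.plus 0 = 0 := by
  have : (0 : ℕ) ≠ p := by omega
  simp [DerSign.plus, this]

theorem Polynomial.Monic.iterate_derivative_natDegree {F : Type*} [Field F] {f : F[X]}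
    (hf : f.Monic) : derivative^[f.natDegree] f = C (f.natDegree.factorial : F) := by
  ext k
  rw [coeff_iterate_derivative, coeff_C]
  split_ifs with hk
  · subst hk
    simp [Nat.descFactorial_self, hf.coeff_natDegree]
  · rw [coeff_eq_zero_of_natDegree_lt (by omega), smul_zero]

variable {R : Type*} [Field R] [LinearOrder R] [IsStrictOrderedRing R]

/-- The conventions `η₊(0) = 0` and `η₊(p) = 1` are the true signs here, since `f(x) = 0` and `f^(p)
= p! > 0`. -/
theorem thomEncoding_plus {f : R[X]} (hf : f.Monic) (hp : 1 ≤ f.natDegree) {x : R}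
    (hx : f.eval x = 0) {h : ℕ} (hh : h ≤ f.natDegree) :
    (thomEncoding f.natDegree f x).plus h = SignType.sign ((derivative^[h] f).eval x) := by
  rcases hh.eq_or_lt with rfl | hlt
  · rw [DerSign.plus_self, hf.iterate_derivative_natDegree, eval_C, sign_pos]
    exact_mod_cast Nat.factorial_pos _
  rcases Nat.eq_zero_or_pos h with rfl | hpos
  · simp [DerSign.plus_zero hp, hx]
  · rw [DerSign.plus_of_mem _ (Finset.mem_Ico.2 ⟨hpos, hlt⟩)]
    rfl

variable [IsRealClosed R]

/-- Descending induction on `q`, starting from the positive constant `f^(p) = p!`: a constant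
nonzero sign of one derivative passes to the one below, whose end signs agree. -/
theorem Polynomial.Monic.exists_sign_derivative_const {f : R[X]} (hf : f.Monic) {x y : R}
    (hxy : x < y) {q : ℕ} (hq : q ≤ f.natDegree)
    (he : ∀ h, q ≤ h → h < f.natDegree → SignType.sign ((derivative^[h] f).eval x) =
      SignType.sign ((derivative^[h] f).eval y)) :
    ∃ s : SignType, s ≠ 0 ∧
      ∀ c, x ≤ c → c ≤ y → SignType.sign ((derivative^[q] f).eval c) = s := by
  induction hq using Nat.decreasingInduction with
  | self =>
    refine ⟨1, by simp, fun c _ _ => ?_⟩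
    rw [hf.iterate_derivative_natDegree, eval_C, sign_pos]
    exact_mod_cast Nat.factorial_pos _
  | of_succ q hq ih =>
    obtain ⟨s, hs, hsc⟩ := ih fun h h1 h2 => he h (by omega) h2
    simp only [Function.iterate_succ', Function.comp_apply] at hsc
    obtain ⟨h1, h2⟩ := sign_eq_of_sign_derivative hxy hs hsc (he q le_rfl hq)
    exact ⟨_, h1, h2⟩

/-- **Thom's lemma**: the Thom encodings of the roots of a monic polynomial are distinct and their
order reflects the order of the roots. -/
theorem Polynomial.Monic.thomEncoding_prec {f : R[X]} (hf : f.Monic) (hp : 1 ≤ f.natDegree)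
    {x y : R} (hx : f.eval x = 0) (hy : f.eval y = 0) (hxy : x < y) :
    (thomEncoding f.natDegree f x).Prec (thomEncoding f.natDegree f y) := by
  classical
  set p := f.natDegree with hpdef
  have hplus : ∀ {h : ℕ}, h ≤ p → ∀ {z}, f.eval z = 0 → (thomEncoding p f z).plus h =
    SignType.sign ((derivative^[h] f).eval z) := fun hh z hz => thomEncoding_plus hf hp hz hh
  -- Were all signs equal from order 0 on, `f` itself would have a constant nonzero sign on `[x,
  -- y]`, against `f(x) = 0`.
  have hex : ∃ q < p, SignType.sign ((derivative^[q] f).eval x) ≠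
      SignType.sign ((derivative^[q] f).eval y) := by
    by_contra hcon
    push Not at hcon
    obtain ⟨s, hs, hsc⟩ := hf.exists_sign_derivative_const hxy (Nat.zero_le _)
      fun h _ hh => hcon h hh
    have := hsc x le_rfl hxy.le
    simp [hx] at this
    exact hs this.symm
  let S := (Finset.range p).filter fun q => SignType.sign ((derivative^[q] f).eval x) ≠
      SignType.sign ((derivative^[q] f).eval y)
  have hS : S.Nonempty := by
    obtain ⟨q, h1, h2⟩ := hex
    exact ⟨q, by simp [S, h1, h2]⟩
  have hmem := S.max'_mem hS
  set q := S.max' hS with hq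
  simp only [S, Finset.mem_filter, Finset.mem_range] at hmem
  have hmax : ∀ h, q < h → h < p → SignType.sign ((derivative^[h] f).eval x) =
      SignType.sign ((derivative^[h] f).eval y) := by
    intro h h1 h2
    by_contra hne
    exact absurd (S.le_max' h (by simp [S, h2, hne])) (not_le.2 h1)
  -- Beyond the last disagreement `q` the signs agree, so `f^(q+1)` has a constant nonzero sign
  -- between `x` and `y`. The mean value theorem for `f^(q)` then gives the direction of the
  -- inequality at `q`.
  obtain ⟨s, hs, hsc⟩ := hf.exists_sign_derivative_const hxy (q := q + 1) (by omega)
    fun h h1 h2 => hmax h (by omega) h2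
  obtain ⟨c, h1, h2, h3⟩ := (derivative^[q] f).exists_derivative_eq_slope hxy
  have hc := hsc c h1.le h2.le
  have hyx := sub_pos.2 hxy
  rw [Function.iterate_succ', Function.comp_apply] at hc
  refine ⟨q, hmem.1, ?_, fun h h1 h2 => ?_, ?_⟩
  · rw [hplus hmem.1.le hx, hplus hmem.1.le hy]
    exact hmem.2
  · rw [hplus h2.le hx, hplus h2.le hy]
    exact hmax h h1 h2
  · rw [hplus hmem.1.le hx, hplus hmem.1.le hy, hplus (by omega) hx, hsc x le_rfl hxy.le]
    have hs' : s = 1 ∨ s = -1 := by cases s <;> simp_all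
    rcases hs' with rfl | rfl
    · left
      refine ⟨lt_of_le_of_ne ?_ hmem.2, rfl⟩
      have := mul_pos (sign_eq_one_iff.1 hc) hyx
      exact SignType.sign.monotone (by linarith)
    · right
      refine ⟨lt_of_le_of_ne ?_ hmem.2.symm, rfl⟩
      have := mul_neg_of_neg_of_pos (sign_eq_neg_one_iff.1 hc) hyx
      exact SignType.sign.monotone (by linarith)

theorem DerSign.Prec.ne {p : ℕ} {η₁ η₂ : DerSign p} (h : η₁.Prec η₂) : η₁ ≠ η₂ := by
  rintro rfl
  obtain ⟨q, _, h, _⟩ := h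
  exact h rfl

theorem Polynomial.Monic.thomEncoding_injOn {f : R[X]} (hf : f.Monic) (hp : 1 ≤ f.natDegree)
    {x y : R} (hx : f.eval x = 0) (hy : f.eval y = 0)
    (h : thomEncoding f.natDegree f x = thomEncoding f.natDegree f y) : x = y := by
  by_contra hne
  rcases lt_or_gt_of_ne hne with hlt | hlt
  · exact (hf.thomEncoding_prec hp hx hy hlt).ne h
  · exact (hf.thomEncoding_prec hp hy hx hlt).ne h.symm

theorem DerSign.Prec.asymm {p : ℕ} {η₁ η₂ : DerSign p} (h : η₁.Prec η₂) : ¬ η₂.Prec η₁ := by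
  rintro ⟨q', hq', hne', heq', hor'⟩
  obtain ⟨q, hq, hne, heq, hor⟩ := h
  have hqq : q' = q := by
    rcases lt_trichotomy q' q with hlt | h | hlt
    · exact absurd (heq' q hlt hq).symm hne
    · exact h
    · exact absurd (heq q' hlt hq').symm hne'
  subst hqq
  -- Either `q' + 1 = p`, where both values are 1, or `q' + 1` lies beyond the last disagreement.
  have hsucc : η₁.plus (q' + 1) = η₂.plus (q' + 1) := by
    rcases (Nat.succ_le_of_lt hq).eq_or_lt with h | h
    · rw [show q' + 1 = p from h, plus_self, plus_self]
    · exact heq _ (Nat.lt_succ_self _) h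
  rw [hsucc] at hor
  rcases hor with ⟨h1, h2⟩ | ⟨h1, h2⟩ <;> rcases hor' with ⟨h3, h4⟩ | ⟨h3, h4⟩
  · exact absurd h1 h3.asymm
  · rw [h2] at hsucc
    rw [h4] at h2
    exact absurd h2 (by decide)
  · rw [h4] at h2
    exact absurd h2 (by decide)
  · exact absurd h1 h3.asymm

theorem DerSign.MuPrec.asymm {p : ℕ} {η₁ η₂ : DerSign p} (h : η₁.MuPrec η₂) :
    ¬ η₂.MuPrec η₁ := by
  rintro (h' | ⟨h', h''⟩) <;> rcases h with h | ⟨h, hp⟩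
  · omega
  · omega
  · omega
  · exact hp.asymm h''

end Thom

/-! ### Traces in `A[y] / (P)` and Hankel determinants -/

section Trace

variable {A : Type*} [CommRing A]

/-- The trace of multiplication by `f` on `A[y] / (P)`, computed in the monomial basis. -/
noncomputable def modTrace (P : A[X]) : A[X] →ₗ[A] A where
  toFun f := ∑ i ∈ Finset.range P.natDegree, ((f * X ^ i) %ₘ P).coeff i
  map_add' f g := by
    simp only [add_mul, add_modByMonic, coeff_add, Finset.sum_add_distrib]
  map_smul' c f := by
    simp only [smul_mul_assoc, smul_modByMonic, coeff_smul, ← Finset.smul_sum, RingHom.id_apply]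

theorem modTrace_apply (P f : A[X]) :
    modTrace P f = ∑ i ∈ Finset.range P.natDegree, ((f * X ^ i) %ₘ P).coeff i := rfl

theorem trace_adjoinRoot_mk {P : A[X]} (hP : P.Monic) (f : A[X]) :
    Algebra.trace A (AdjoinRoot P) (AdjoinRoot.mk P f) = modTrace P f := by
  classical
  have hb : ∀ i : Fin P.natDegree, AdjoinRoot.powerBasisAux' hP i = AdjoinRoot.mk P (X ^ (i : ℕ)) := by
    intro i
    have := (AdjoinRoot.powerBasis' hP).basis_eq_pow i
    rwa [AdjoinRoot.powerBasis'_gen, ← AdjoinRoot.mk_X, ← map_pow] at this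
  rw [Algebra.trace_eq_matrix_trace (AdjoinRoot.powerBasisAux' hP), Matrix.trace,
    modTrace_apply, ← Fin.sum_univ_eq_sum_range (fun i => ((f * X ^ i) %ₘ P).coeff i)]
  refine Finset.sum_congr rfl fun i _ => ?_
  rw [Matrix.diag_apply, Algebra.leftMulMatrix_eq_repr_mul, hb, ← map_mul,
    AdjoinRoot.powerBasisAux'_repr_apply_to_fun, AdjoinRoot.modByMonicHom_mk]

theorem map_modTrace {B : Type*} [CommRing B] [Nontrivial B] (φ : A →+* B) {P : A[X]}
    (hP : P.Monic) (f : A[X]) : φ (modTrace P f) = modTrace (P.map φ) (f.map φ) := by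
  rw [modTrace_apply, modTrace_apply, map_sum, hP.natDegree_map]
  refine Finset.sum_congr rfl fun i _ => ?_
  rw [← coeff_map, map_modByMonic φ hP, Polynomial.map_mul, Polynomial.map_pow, map_X]

/-- A remainder modulo `(X - a) P` is the remainder modulo `P` plus the value at `a` of the quotient
by `P`, times `P`. The extra terms sum to `f(a)`. No eigenvalues are used, so this holds over any
nontrivial commutative ring. -/
theorem modTrace_X_sub_C_mul [Nontrivial A] (a : A) {P : A[X]} (hP : P.Monic) (f : A[X]) :
    modTrace ((X - C a) * P) f = f.eval a + modTrace P f := by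
  set d := P.natDegree with hd
  have hXP : ((X - C a) * P).Monic := (monic_X_sub_C a).mul hP
  have hdeg : ((X - C a) * P).natDegree = d + 1 := by
    rw [(monic_X_sub_C a).natDegree_mul hP, natDegree_X_sub_C, add_comm]
  have hmod : ∀ g : A[X], g %ₘ ((X - C a) * P) = g %ₘ P + C ((g /ₘ P).eval a) * P := by
    intro g
    refine (div_modByMonic_unique ((g /ₘ P) /ₘ (X - C a)) _ hXP ⟨?_, ?_⟩).2
    · have h1 := modByMonic_add_div g P
      have h2 := modByMonic_add_div (g /ₘ P) (X - C a)
      rw [modByMonic_X_sub_C_eq_C_eval] at h2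
      linear_combination h1 + P * h2
    · have hlt : P.degree < ((X - C a) * P).degree := by
        rw [degree_eq_natDegree hP.ne_zero, degree_eq_natDegree hXP.ne_zero, hdeg]
        exact_mod_cast Nat.lt_succ_self _
      refine (degree_add_le _ _).trans_lt (max_lt ((degree_modByMonic_lt _ hP).trans hlt) ?_)
      refine lt_of_le_of_lt ?_ hlt
      rw [← smul_eq_C_mul]
      exact degree_smul_le _ _
  have hPsum : P = ∑ i ∈ Finset.range (d + 1), C (P.coeff i) * X ^ i := P.as_sum_range_C_mul_X_pow
  -- By linearity of division, the left side is the quotient of `f * P` by `P`.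
  have hq : ∑ i ∈ Finset.range (d + 1), P.coeff i • ((f * X ^ i) /ₘ P) = f := by
    refine (div_modByMonic_unique (f := f * P) _
      (∑ i ∈ Finset.range (d + 1), P.coeff i • ((f * X ^ i) %ₘ P)) hP ⟨?_, ?_⟩).1.symm.trans ?_
    · conv_rhs => rw [hPsum, Finset.mul_sum]
      rw [Finset.mul_sum, ← Finset.sum_add_distrib]
      refine Finset.sum_congr rfl fun i _ => ?_
      have h1 := modByMonic_add_div (f * X ^ i) P
      rw [smul_eq_C_mul, smul_eq_C_mul]
      linear_combination C (P.coeff i) * h1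
    · refine (degree_sum_le _ _).trans_lt ((Finset.sup_lt_iff ?_).2 fun i _ => ?_)
      · exact bot_lt_iff_ne_bot.2 (degree_ne_bot.2 hP.ne_zero)
      · exact (degree_smul_le _ _).trans_lt (degree_modByMonic_lt _ hP)
    · exact (div_modByMonic_unique f 0 hP ⟨by ring, by simpa using bot_lt_iff_ne_bot.2 (degree_ne_bot.2 hP.ne_zero)⟩).1
  -- The larger trace has one more diagonal term, `i = d`, to which the remainder modulo `P`
  -- contributes nothing.
  have hlast : ((f * X ^ d) %ₘ P).coeff d = 0 :=
    coeff_eq_zero_of_degree_lt ((degree_modByMonic_lt _ hP).trans_le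
      (by rw [degree_eq_natDegree hP.ne_zero]))
  have hev := congrArg (eval a) hq
  rw [eval_finsetSum] at hev
  rw [modTrace_apply, modTrace_apply, hdeg, ← hd]
  simp only [hmod, coeff_add, coeff_C_mul]
  rw [Finset.sum_add_distrib, Finset.sum_range_succ, hlast, add_zero, add_comm, ← hev]
  congr 1
  exact Finset.sum_congr rfl fun i _ => by rw [eval_smul, smul_eq_mul, mul_comm]

theorem modTrace_prod_X_sub_C [Nontrivial A] (s : Multiset A) (f : A[X]) :
    modTrace (s.map fun a => X - C a).prod f = (s.map fun a => f.eval a).sum := by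
  induction s using Multiset.induction_on with
  | empty => simp [modTrace_apply]
  | cons a s ih =>
    rw [Multiset.map_cons, Multiset.prod_cons, Multiset.map_cons, Multiset.sum_cons,
      modTrace_X_sub_C_mul a (monic_multiset_prod_of_monic _ _ fun a _ => monic_X_sub_C a), ih]

theorem modTrace_eq_sum_roots {F : Type*} [Field F] [IsAlgClosed F] [DecidableEq F] {P : F[X]}
    (hP : P.Monic) (f : F[X]) :
    modTrace P f = ∑ z ∈ P.roots.toFinset, (P.rootMultiplicity z : F) * f.eval z := by
  conv_lhs => rw [(IsAlgClosed.splits P).eq_prod_roots_of_monic hP]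
  rw [modTrace_prod_X_sub_C, Finset.sum_multiset_map_count]
  exact Finset.sum_congr rfl fun z _ => by rw [count_roots, nsmul_eq_mul]

/-- The matrix `(ℓ (X ^ (i + j)))` of order `h`. -/
noncomputable def hankelMatrix (ℓ : A[X] →ₗ[A] A) (h : ℕ) : Matrix (Fin h) (Fin h) A :=
  Matrix.of fun i j => ℓ (X ^ ((i : ℕ) + (j : ℕ)))

/-- The determinant of the Hankel matrix of order `h`. -/
noncomputable def hankelDet (ℓ : A[X] →ₗ[A] A) (h : ℕ) : A := (hankelMatrix ℓ h).det

/-- The functional `f ↦ Tr (B f)` on `A[y] / (P)`. -/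
noncomputable def hermiteFunctional (P B : A[X]) : A[X] →ₗ[A] A :=
  modTrace P ∘ₗ LinearMap.mulLeft A B

theorem hermiteFunctional_apply (P B f : A[X]) : hermiteFunctional P B f = modTrace P (B * f) :=
  rfl

theorem map_hermiteFunctional {B : Type*} [CommRing B] [Nontrivial B] (φ : A →+* B) {P : A[X]}
    (hP : P.Monic) (Q f : A[X]) :
    φ (hermiteFunctional P Q f) = hermiteFunctional (P.map φ) (Q.map φ) (f.map φ) := by
  rw [hermiteFunctional_apply, map_modTrace φ hP, Polynomial.map_mul, hermiteFunctional_apply]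

/-- Division by a monic polynomial commutes with ring homomorphisms. This serves both for
specializing the parameters and for passing from `R` to `R(i)`. -/
theorem map_hankelDet {B : Type*} [CommRing B] [Nontrivial B] (φ : A →+* B) {P : A[X]}
    (hP : P.Monic) (Q : A[X]) (h : ℕ) : φ (hankelDet (hermiteFunctional P Q) h) =
      hankelDet (hermiteFunctional (P.map φ) (Q.map φ)) h := by
  rw [hankelDet, RingHom.map_det, hankelDet]
  congr 1
  ext i j
  simp [hankelMatrix, map_hermiteFunctional φ hP]

theorem hankelDet_mem_hermiteMinors {P : A[X]} (hP : P.Monic) (Q : A[X]) {r : ℕ} (hr0 : 1 ≤ r)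
    (hr : r ≤ P.natDegree) : hankelDet (hermiteFunctional P Q) r ∈ hermiteMinors P Q := by
  refine ⟨r, hr, hr0, ?_⟩
  rw [hankelDet]
  congr 1
  ext i j
  simp [hankelMatrix, hermiteMatrix, hermiteFunctional_apply, trace_adjoinRoot_mk hP, -map_mul]

end Trace

/-! ### Signatures of Hankel forms -/

section HankelField

variable {F : Type*} [Field F] [DecidableEq F]

theorem Polynomial.ofFn_toFn_of_degree_lt {n : ℕ} {f : F[X]} (hf : f.degree < n) :
    ofFn n (toFn n f) = f := by
  ext i
  by_cases h : i < n
  · simp [h, toFn]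
  · have : f.coeff i = 0 :=
      coeff_eq_zero_of_degree_lt (hf.trans_le (by exact_mod_cast not_lt.1 h))
    simp [this, not_lt.1 h]

omit [DecidableEq F] in
theorem map_mul_eq_sum (ℓ : F[X] →ₗ[F] F) (f g : F[X]) {n : ℕ} (hg : g.natDegree < n) :
    ℓ (f * g) = ∑ i ∈ Finset.range n, g.coeff i * ℓ (f * X ^ i) := by
  conv_lhs => rw [as_sum_range_C_mul_X_pow' g hg, Finset.mul_sum, map_sum]
  refine Finset.sum_congr rfl fun i _ => ?_
  rw [← smul_eq_C_mul, mul_smul_comm, map_smul, smul_eq_mul]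

omit [DecidableEq F] in
theorem map_mul_eq_zero (ℓ : F[X] →ₗ[F] F) {f g : F[X]} {n : ℕ}
    (h : ∀ i < n, ℓ (f * X ^ i) = 0) (hg : g.degree < n) : ℓ (f * g) = 0 := by
  by_cases hg0 : g = 0
  · simp [hg0]
  rw [map_mul_eq_sum ℓ f g ((natDegree_lt_iff_degree_lt hg0).2 hg)]
  exact Finset.sum_eq_zero fun i hi => by rw [h i (Finset.mem_range.1 hi), mul_zero]

theorem hankelMatrix_mulVec (ℓ : F[X] →ₗ[F] F) {h : ℕ} (v : Fin h → F) (i : Fin h) :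
    (hankelMatrix ℓ h).mulVec v i = ℓ (ofFn h v * X ^ (i : ℕ)) := by
  rw [ofFn_eq_sum_monomial, Finset.sum_mul, map_sum, Matrix.mulVec, dotProduct]
  refine Finset.sum_congr rfl fun j _ => ?_
  rw [← C_mul_X_pow_eq_monomial, mul_assoc, ← pow_add, ← smul_eq_C_mul, map_smul, smul_eq_mul,
    hankelMatrix, Matrix.of_apply, mul_comm, add_comm]

/-- A kernel vector of the Hankel matrix is the coefficient vector of a polynomial of degree `< h`
orthogonal to `1, …, X^(h-1)`. -/
theorem hankelDet_ne_zero_iff (ℓ : F[X] →ₗ[F] F) (h : ℕ) : hankelDet ℓ h ≠ 0 ↔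
    ∀ f : F[X], f.degree < h → (∀ i < h, ℓ (f * X ^ i) = 0) → f = 0 := by
  rw [Ne, hankelDet, ← Matrix.exists_mulVec_eq_zero_iff, not_exists]
  constructor
  · intro H f hf hfi
    by_contra hf0
    refine H (toFn h f) ⟨fun h0 => hf0 ?_, ?_⟩
    · rw [← ofFn_toFn_of_degree_lt hf, h0, map_zero]
    · ext i
      rw [hankelMatrix_mulVec, ofFn_toFn_of_degree_lt hf]
      exact hfi i i.2
  · rintro H v ⟨hv, hv0⟩
    refine hv (injective_ofFn h ?_)
    rw [map_zero]
    refine H _ (ofFn_degree_lt v) fun i hi => ?_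
    have := congrFun hv0 ⟨i, hi⟩
    rwa [hankelMatrix_mulVec] at this

theorem exists_monic_orthogonal (ℓ : F[X] →ₗ[F] F) {h : ℕ} (hD : hankelDet ℓ h ≠ 0) :
    ∃ π : F[X], π.Monic ∧ π.natDegree = h ∧ ∀ j < h, ℓ (π * X ^ j) = 0 := by
  obtain ⟨v, hv⟩ := (Matrix.mulVec_surjective_iff_isUnit.2
    ((Matrix.isUnit_iff_isUnit_det _).2 (isUnit_iff_ne_zero.2 hD)))
    fun i : Fin h => ℓ (X ^ h * X ^ (i : ℕ))
  have hdeg : (-ofFn h v).degree < h := by rw [degree_neg]; exact ofFn_degree_lt v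
  refine ⟨X ^ h + -ofFn h v, monic_X_pow_add hdeg, ?_, fun j hj => ?_⟩
  · exact natDegree_eq_of_degree_eq_some (by
      rw [degree_add_eq_left_of_degree_lt (by rwa [degree_X_pow]), degree_X_pow])
  · have := congrFun hv ⟨j, hj⟩
    rw [hankelMatrix_mulVec] at this
    simp only at this
    rw [add_mul, neg_mul, map_add, map_neg, this, add_neg_cancel]

/-- The vanishing of the minors between `h` and `k` extends the orthogonality of `π` up to
`X^(k-2)`. If `j` were the first exponent with `ℓ(π X^j) ≠ 0` and `j + 1 < k`, the minor of order `j
+ 1` would be nonzero: a kernel polynomial `f` has remainder 0 modulo `π` because the minor of order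
`h` is nonzero, and its quotient is killed by testing against one further power of `X`. -/
theorem map_monic_orthogonal_eq_zero (ℓ : F[X] →ₗ[F] F) {h k : ℕ} (hD : hankelDet ℓ h ≠ 0)
    (hD0 : ∀ j, h < j → j < k → hankelDet ℓ j = 0) {π : F[X]} (hπ : π.Monic)
    (hdeg : π.natDegree = h) (horth : ∀ j < h, ℓ (π * X ^ j) = 0) :
    ∀ j, j + 1 < k → ℓ (π * X ^ j) = 0 := by
  intro j
  induction j using Nat.strong_induction_on with
  | _ j ih =>
    intro hjk
    by_cases hjh : j < h
    · exact horth j hjh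
    push Not at hjh
    have hlow : ∀ i < j, ℓ (π * X ^ i) = 0 := fun i hi => ih i hi (by omega)
    by_contra hc
    refine absurd (hD0 (j + 1) (by omega) hjk) ((hankelDet_ne_zero_iff ℓ (j + 1)).2 ?_)
    intro f hf hfi
    by_contra hf0
    set g := f /ₘ π with hg
    have hdiv := modByMonic_add_div f π
    have hfn : f.natDegree < j + 1 := (natDegree_lt_iff_degree_lt hf0).2 hf
    have hgn : g.natDegree = f.natDegree - h := by rw [hg, natDegree_divByMonic f hπ, hdeg]
    have hr0 : f %ₘ π = 0 := by
      refine (hankelDet_ne_zero_iff ℓ h).1 hD _ ?_ fun i hi => ?_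
      · rw [← hdeg, ← degree_eq_natDegree hπ.ne_zero]
        exact degree_modByMonic_lt f hπ
      · have h1 : ℓ (π * (g * X ^ i)) = 0 := by
          refine map_mul_eq_zero ℓ hlow ((degree_le_natDegree).trans_lt ?_)
          have := natDegree_mul_le (p := g) (q := X ^ i)
          rw [natDegree_X_pow] at this
          exact_mod_cast (by omega : (g * X ^ i).natDegree < j)
        have h2 : f %ₘ π = f - π * g := eq_sub_of_add_eq hdiv
        rw [h2, sub_mul, map_sub, hfi i (by omega), mul_assoc, h1, sub_zero]
    rw [hr0, zero_add] at hdiv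
    have hg0 : g ≠ 0 := by
      intro h0
      rw [← hg, h0, mul_zero] at hdiv
      exact hf0 hdiv.symm
    have he : g.natDegree ≤ j := by omega
    -- This power raises the quotient to degree exactly `j`, so only the term `leadingCoeff g · ℓ(π
    -- X^j)` survives.
    have hfin := hfi (j - g.natDegree) (by omega)
    have hgX : (g * X ^ (j - g.natDegree)).natDegree = j := by
      rw [natDegree_mul hg0 (pow_ne_zero _ X_ne_zero), natDegree_X_pow]
      omega
    rw [← hdiv, mul_assoc, map_mul_eq_sum ℓ π _ (Nat.lt_succ_of_le hgX.le),
      Finset.sum_range_succ, Finset.sum_eq_zero, zero_add, coeff_mul_X_pow', if_pos (by omega)] at hfin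
    · rw [show j - (j - g.natDegree) = g.natDegree by omega] at hfin
      exact mul_ne_zero (leadingCoeff_ne_zero.2 hg0) hc hfin
    · intro i hi
      rw [hlow i (Finset.mem_range.1 hi), mul_zero]

end HankelField

/-! ### Index growth of Hankel forms and Frobenius' rule -/

section HankelForm

variable {R : Type*} [Field R] [LinearOrder R]

/-- The quadratic form `v ↦ ℓ (f ^ 2)`, where `f` has coefficients `v`. -/
noncomputable def hankelForm (ℓ : R[X] →ₗ[R] R) (h : ℕ) : QuadraticForm R (Fin h → R) :=
  (LinearMap.BilinMap.toQuadraticMap ((LinearMap.mul R R[X]).compr₂ ℓ)).comp (ofFn h)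

theorem hankelForm_apply (ℓ : R[X] →ₗ[R] R) {h : ℕ} (v : Fin h → R) :
    hankelForm ℓ h v = ℓ (ofFn h v * ofFn h v) := rfl

theorem hankelForm_toFn (ℓ : R[X] →ₗ[R] R) {h : ℕ} {f : R[X]} (hf : f.degree < h) :
    hankelForm ℓ h (toFn h f) = ℓ (f * f) := by
  rw [hankelForm_apply, ofFn_toFn_of_degree_lt hf]

theorem hankelForm_neg (ℓ : R[X] →ₗ[R] R) (h : ℕ) : hankelForm (-ℓ) h = -hankelForm ℓ h := by
  ext v
  simp [hankelForm_apply]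

omit [LinearOrder R] in
theorem hankelDet_neg_eq_zero_iff (ℓ : R[X] →ₗ[R] R) (h : ℕ) :
    hankelDet (-ℓ) h = 0 ↔ hankelDet ℓ h = 0 := by
  have : hankelMatrix (-ℓ) h = -hankelMatrix ℓ h := by
    ext i j
    simp [hankelMatrix]
  rw [hankelDet, this, Matrix.det_neg, hankelDet]
  simp

variable [IsStrictOrderedRing R]

theorem hankelForm_discr [Invertible (2 : R)] (ℓ : R[X] →ₗ[R] R) (h : ℕ) :
    QuadraticForm.discr' (hankelForm ℓ h) = hankelDet ℓ h := by
  rw [QuadraticForm.discr', hankelDet]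
  congr 1
  ext i j
  have hs : ∀ i : Fin h, ofFn h (Pi.single i (1 : R)) = X ^ (i : ℕ) := by
    intro i
    rw [ofFn_eq_sum_monomial, Finset.sum_eq_single i]
    · simp [monomial_one_right_eq_X_pow]
    · intro j _ hj
      simp [hj]
    · simp
  rw [QuadraticForm.toMatrix', LinearMap.toMatrix₂'_apply, hankelForm,
    QuadraticMap.associated_comp, LinearMap.compl₁₂_apply, hs, hs, hankelMatrix, Matrix.of_apply,
    QuadraticMap.associated_left_inverse R (fun x y => by simp [mul_comm]), pow_add]
  rfl

/-- After diagonalization the discriminant is the product of the weights times a nonzero square, so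
its sign counts the negative weights modulo 2. -/
theorem sign_discr_eq [Invertible (2 : R)] {h : ℕ} (q : QuadraticForm R (Fin h → R))
    (hq : QuadraticForm.discr' q ≠ 0) :
    sigPos q + sigNeg q = h ∧ SignType.sign (QuadraticForm.discr' q) = (-1) ^ sigNeg q := by
  obtain ⟨n, hn, w, hw⟩ : ∃ n, n = h ∧ ∃ w : Fin n → R,
      QuadraticMap.Equivalent q (QuadraticMap.weightedSumSquares R w) :=
    ⟨_, Module.finrank_fin_fun R, q.equivalent_weightedSumSquares⟩
  subst hn
  have hdiag : QuadraticForm.discr' (QuadraticMap.weightedSumSquares R w) = ∏ i, w i := by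
    have hB : QuadraticMap.weightedSumSquares R w = LinearMap.BilinMap.toQuadraticMap
        (Matrix.toLinearMap₂' R (Matrix.diagonal w)) := by
      ext v
      simp only [QuadraticMap.weightedSumSquares_apply, LinearMap.BilinMap.toQuadraticMap_apply,
        Matrix.toLinearMap₂'_apply', Matrix.mulVec_diagonal, dotProduct, smul_eq_mul]
      exact Finset.sum_congr rfl fun i _ => by ring
    rw [QuadraticForm.discr', ← Matrix.det_diagonal, hB, QuadraticForm.toMatrix',
      QuadraticMap.associated_left_inverse R, LinearMap.toMatrix'_toLinearMap₂']
    intro x y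
    simp only [Matrix.toLinearMap₂'_apply', Matrix.mulVec_diagonal, dotProduct]
    exact Finset.sum_congr rfl fun i _ => by ring
  obtain ⟨e⟩ := hw
  have hcomp : q = (QuadraticMap.weightedSumSquares R w).comp
      (e.toLinearEquiv : (Fin n → R) →ₗ[R] (Fin n → R)) := by
    ext v
    exact (e.map_app v).symm
  have hdet := QuadraticForm.discr'_comp (Q := QuadraticMap.weightedSumSquares R w)
    (e.toLinearEquiv : (Fin n → R) →ₗ[R] (Fin n → R))
  rw [← hcomp, hdiag] at hdet
  rw [hdet] at hq ⊢
  have hd := left_ne_zero_of_mul (left_ne_zero_of_mul hq)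
  have hw0 : ∀ i, w i ≠ 0 := fun i => Finset.prod_ne_zero_iff.1 (right_ne_zero_of_mul hq) i
    (Finset.mem_univ i)
  rw [QuadraticForm.sigPos_of_equiv_weightedSumSquares ⟨e⟩,
    QuadraticForm.sigNeg_of_equiv_weightedSumSquares ⟨e⟩, sign_mul, sign_pos (mul_self_pos.2 hd),
    one_mul]
  constructor
  · have hdisj : Disjoint {i | 0 < w i} {i | w i < 0} :=
      Set.disjoint_left.2 fun i (h1 : 0 < w i) (h2 : w i < 0) => absurd h1 h2.not_gt
    have : {i | 0 < w i} ∪ {i | w i < 0} = Set.univ := by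
      ext i
      simpa using (hw0 i).symm.lt_or_gt
    rw [← Set.ncard_union_eq hdisj, this, Set.ncard_univ, Nat.card_fin]
  · have hs : ∀ i, SignType.sign (w i) = if w i < 0 then -1 else 1 := by
      intro i
      split_ifs with h
      · exact sign_neg h
      · exact sign_pos (lt_of_le_of_ne (not_lt.1 h) (hw0 i).symm)
    calc SignType.sign (∏ i, w i) = ∏ i, SignType.sign (w i) := map_prod signHom _ _
      _ = ∏ i, if w i < 0 then (-1 : SignType) else 1 := Finset.prod_congr rfl fun i _ => hs i
      _ = (-1) ^ {i | w i < 0}.ncard := by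
        rw [Finset.prod_ite, Finset.prod_const, Finset.prod_const_one, mul_one,
          Set.ncard_eq_toFinset_card', Set.toFinset_ofPred]

theorem hankelForm_signature (ℓ : R[X] →ₗ[R] R) {h : ℕ} (hD : hankelDet ℓ h ≠ 0) :
    sigPos (hankelForm ℓ h) + sigNeg (hankelForm ℓ h) = h ∧
      SignType.sign (hankelDet ℓ h) = (-1) ^ sigNeg (hankelForm ℓ h) := by
  have : Invertible (2 : R) := invertibleOfNonzero two_ne_zero
  rw [← hankelForm_discr] at hD ⊢
  exact sign_discr_eq _ hD

/-- A lower bound for the growth of the positive index across a gap in the sequence of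
nonvanishing Hankel determinants. -/
theorem sigPos_hankelForm_add_le (ℓ : R[X] →ₗ[R] R) {h k m : ℕ} (hm : h + 2 * m ≤ k)
    (hm' : h < k) (hDh : hankelDet ℓ h ≠ 0) (hDk : hankelDet ℓ k ≠ 0)
    (hD0 : ∀ j, h < j → j < k → hankelDet ℓ j = 0) :
    sigPos (hankelForm ℓ h) + m ≤ sigPos (hankelForm ℓ k) := by
  obtain ⟨π, hπ, hdeg, horth⟩ := exists_monic_orthogonal ℓ hDh
  have hz := map_monic_orthogonal_eq_zero ℓ hDh hD0 hπ hdeg horth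
  have hz' : ∀ i < k - 1, ℓ (π * X ^ i) = 0 := fun i hi => hz i (by omega)
  obtain ⟨V, hV, hpos⟩ := exists_finrank_eq_sigPos_and_posDef (hankelForm ℓ h)
  -- A maximal positive definite subspace at order `h` is enlarged by the multiples `π g` with `deg
  -- g < m`. These contribute nothing to the form, so it stays nonnegative on a space of dimension
  -- larger by `m`.
  let T₀ : V × (Fin m → R) →ₗ[R] R[X] :=
    ((ofFn h).comp V.subtype).coprod ((LinearMap.mulLeft R π).comp (ofFn m))
  have hT₀ : ∀ x, T₀ x = ofFn h (x.1 : Fin h → R) + π * ofFn m x.2 := fun x => rfl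
  have hπd : π.degree = h := by rw [degree_eq_natDegree hπ.ne_zero, hdeg]
  have hT₀deg : ∀ x, (T₀ x).degree < k := by
    intro x
    rw [hT₀]
    refine (degree_add_le _ _).trans_lt (max_lt ?_ ?_)
    · exact (ofFn_degree_lt _).trans_le (by exact_mod_cast hm'.le)
    · by_cases h0 : ofFn m x.2 = 0
      · rw [h0, mul_zero, degree_zero]
        exact WithBot.bot_lt_coe k
      · have hlt := (natDegree_lt_iff_degree_lt h0).2 (ofFn_degree_lt x.2)
        refine degree_le_natDegree.trans_lt ?_
        have := natDegree_mul_le (p := π) (q := ofFn m x.2)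
        exact_mod_cast (by omega : (π * ofFn m x.2).natDegree < k)
  -- Both components are recovered as remainder and quotient in the division by `π`.
  have hinj : Function.Injective ((toFn k).comp T₀) := by
    rw [← LinearMap.ker_eq_bot, LinearMap.ker_eq_bot']
    intro x hx
    rw [LinearMap.comp_apply] at hx
    have h0 : T₀ x = 0 := by rw [← ofFn_toFn_of_degree_lt (hT₀deg x), hx, map_zero]
    rw [hT₀] at h0
    have huniq := div_modByMonic_unique (f := (0 : R[X])) (ofFn m x.2)
      (ofFn h (x.1 : Fin h → R)) hπ ⟨h0, by rw [hπd]; exact ofFn_degree_lt _⟩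
    rw [zero_divByMonic, zero_modByMonic] at huniq
    refine Prod.ext (Subtype.ext (injective_ofFn h ?_)) (injective_ofFn m ?_)
    · rw [← huniq.2]; simp
    · rw [← huniq.1]; simp
  have hnonneg : ∀ y ∈ LinearMap.range ((toFn k).comp T₀), (-hankelForm ℓ k) y ≤ 0 := by
    rintro _ ⟨x, rfl⟩
    rw [LinearMap.comp_apply, neg_apply, neg_nonpos,
      hankelForm_toFn ℓ (hT₀deg x), hT₀]
    set f := ofFn h (x.1 : Fin h → R)
    set g := ofFn m x.2
    -- Here `h + 2m ≤ k` enters: `deg(π g²) ≤ h + 2(m - 1) < k - 1`, within the range where `π` is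
    -- orthogonal.
    have h1 : ℓ (π * (f * g + f * g + π * g * g)) = 0 := by
      refine map_mul_eq_zero ℓ hz' ?_
      by_cases hg0 : g = 0
      · rw [hg0]
        simp
      have hg := (natDegree_lt_iff_degree_lt hg0).2 (ofFn_degree_lt x.2)
      have hπg : (π * g * g).natDegree < k - 1 := by
        have h1 := natDegree_mul_le (p := π * g) (q := g)
        have h2 := natDegree_mul_le (p := π) (q := g)
        omega
      have hfg : (f * g).degree < (k - 1 : ℕ) := by
        by_cases hf0 : f = 0
        · rw [hf0, zero_mul, degree_zero]
          exact WithBot.bot_lt_coe _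
        have hf := (natDegree_lt_iff_degree_lt hf0).2 (ofFn_degree_lt (x.1 : Fin h → R))
        have := natDegree_mul_le (p := f) (q := g)
        exact degree_le_natDegree.trans_lt
          (by exact_mod_cast (by omega : (f * g).natDegree < k - 1))
      refine (degree_add_le _ _).trans_lt (max_lt ((degree_add_le _ _).trans_lt
        (max_lt hfg hfg)) ?_)
      exact degree_le_natDegree.trans_lt (by exact_mod_cast hπg)
    have h2 : (f + π * g) * (f + π * g) = f * f + π * (f * g + f * g + π * g * g) := by ring
    rw [h2, map_add, h1, add_zero]
    by_cases hx0 : x.1 = 0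
    · have : f = 0 := by simp [f, hx0]
      simp [this]
    · have := hpos x.1 hx0
      rw [QuadraticMap.restrict_apply, hankelForm_apply] at this
      exact this.le
  -- Applied to the negated form, this bounds the negative index at order `k`; nondegeneracy
  -- converts it into a bound for the positive one.
  have hle := QuadraticForm.sigPos_add_finrank_le_of_nonpos hnonneg
  rw [LinearMap.finrank_range_of_inj hinj, Module.finrank_prod, hV, Module.finrank_fin_fun,
    Module.finrank_fin_fun, sigPos_neg] at hle
  have := (hankelForm_signature ℓ hDk).1
  omega

theorem sigNeg_hankelForm_add_le (ℓ : R[X] →ₗ[R] R) {h k m : ℕ} (hm : h + 2 * m ≤ k)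
    (hm' : h < k) (hDh : hankelDet ℓ h ≠ 0) (hDk : hankelDet ℓ k ≠ 0)
    (hD0 : ∀ j, h < j → j < k → hankelDet ℓ j = 0) :
    sigNeg (hankelForm ℓ h) + m ≤ sigNeg (hankelForm ℓ k) := by
  have := sigPos_hankelForm_add_le (-ℓ) hm hm' (by rwa [Ne, hankelDet_neg_eq_zero_iff])
    (by rwa [Ne, hankelDet_neg_eq_zero_iff])
    (fun j h1 h2 => (hankelDet_neg_eq_zero_iff ℓ j).2 (hD0 j h1 h2))
  rwa [hankelForm_neg, hankelForm_neg, sigPos_neg, sigPos_neg] at this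

/-- **Frobenius**: the signs of the leading principal minors of a nonsingular Hankel matrix
determine its signature. -/
theorem signature_eq_of_sign_hankelDet_eq (ℓ₁ ℓ₂ : R[X] →ₗ[R] R) {d : ℕ}
    (hs : ∀ h ≤ d, SignType.sign (hankelDet ℓ₁ h) = SignType.sign (hankelDet ℓ₂ h))
    (hd : hankelDet ℓ₁ d ≠ 0) :
    sigPos (hankelForm ℓ₁ d) = sigPos (hankelForm ℓ₂ d) ∧
      sigNeg (hankelForm ℓ₁ d) = sigNeg (hankelForm ℓ₂ d) := by
  classical
  have hz : ∀ h ≤ d, (hankelDet ℓ₁ h = 0 ↔ hankelDet ℓ₂ h = 0) := fun h hh => by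
    rw [← sign_eq_zero_iff, hs h hh, sign_eq_zero_iff]
  induction d using Nat.strong_induction_on with
  | _ k ih =>
    have hd₂ : hankelDet ℓ₂ k ≠ 0 := fun h0 => hd ((hz k le_rfl).2 h0)
    obtain ⟨e₁, s₁⟩ := hankelForm_signature ℓ₁ hd
    obtain ⟨e₂, s₂⟩ := hankelForm_signature ℓ₂ hd₂
    rcases Nat.eq_zero_or_pos k with rfl | hk
    · omega
    -- The comparison goes back to the last earlier order with a nonzero minor; one exists because
    -- the minor of order 0 is 1.
    let S := (Finset.range k).filter fun h => hankelDet ℓ₁ h ≠ 0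
    have hS : S.Nonempty := ⟨0, Finset.mem_filter.2 ⟨Finset.mem_range.2 hk, by
      rw [hankelDet, Matrix.det_isEmpty]; exact one_ne_zero⟩⟩
    have hmem := S.max'_mem hS
    set h := S.max' hS with hh
    simp only [S, Finset.mem_filter, Finset.mem_range] at hmem
    have hmax : ∀ j, h < j → j < k → hankelDet ℓ₁ j = 0 := by
      intro j h1 h2
      by_contra hne
      exact absurd (S.le_max' j (by simp [S, h2, hne])) (not_le.2 h1)
    have hmax₂ : ∀ j, h < j → j < k → hankelDet ℓ₂ j = 0 := fun j h1 h2 =>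
      (hz j h2.le).1 (hmax j h1 h2)
    have hh₂ : hankelDet ℓ₂ h ≠ 0 := fun h0 => hmem.2 ((hz h hmem.1.le).2 h0)
    obtain ⟨i₁, i₂⟩ := ih h hmem.1 (fun j hj => hs j (hj.trans hmem.1.le)) hmem.2
      (fun j hj => hz j (hj.trans hmem.1.le))
    -- Across the gap each index grows by at least `⌊(k - h) / 2⌋`, and together they grow by `k -
    -- h`. An even gap leaves no choice; an odd one leaves a single unit, placed by the parity of
    -- the negative index, that is, by the sign of the minor of order `k`.
    have hm : h + 2 * ((k - h) / 2) ≤ k := by omega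
    have a₁ := sigPos_hankelForm_add_le ℓ₁ hm hmem.1 hmem.2 hd hmax
    have b₁ := sigNeg_hankelForm_add_le ℓ₁ hm hmem.1 hmem.2 hd hmax
    have a₂ := sigPos_hankelForm_add_le ℓ₂ hm hmem.1 hh₂ hd₂ hmax₂
    have b₂ := sigNeg_hankelForm_add_le ℓ₂ hm hmem.1 hh₂ hd₂ hmax₂
    have c₁ := (hankelForm_signature ℓ₁ hmem.2).1
    have hpar : (-1 : SignType) ^ sigNeg (hankelForm ℓ₁ k) = (-1) ^ sigNeg (hankelForm ℓ₂ k) := by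
      rw [← s₁, ← s₂, hs k le_rfl]
    have hpar' : sigNeg (hankelForm ℓ₁ k) % 2 = sigNeg (hankelForm ℓ₂ k) % 2 := by
      rcases Nat.even_or_odd (sigNeg (hankelForm ℓ₁ k)) with h1 | h1 <;>
        rcases Nat.even_or_odd (sigNeg (hankelForm ℓ₂ k)) with h2 | h2
      · rw [Nat.even_iff.1 h1, Nat.even_iff.1 h2]
      · rw [h1.neg_one_pow, h2.neg_one_pow] at hpar
        exact absurd hpar (by decide)
      · rw [h1.neg_one_pow, h2.neg_one_pow] at hpar
        exact absurd hpar (by decide)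
      · rw [Nat.odd_iff.1 h1, Nat.odd_iff.1 h2]
    omega

end HankelForm

/-! ### Hermite's theorem -/

section PointFunctional

variable {F : Type*} [Field F] [DecidableEq F]

/-- Testing a kernel polynomial against `∏_{y ≠ z} (X - y)` isolates its value at `z`. So it
vanishes at all points of `Z`, more than its degree allows. -/
theorem hankelDet_card_ne_zero {ℓ : F[X] →ₗ[F] F} {Z : Finset F} {w : F → F}
    (hℓ : ∀ f, ℓ f = ∑ z ∈ Z, w z * f.eval z) (hw : ∀ z ∈ Z, w z ≠ 0) :
    hankelDet ℓ Z.card ≠ 0 := by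
  rw [hankelDet_ne_zero_iff]
  intro f hf hfi
  refine eq_zero_of_degree_lt_of_eval_finset_eq_zero Z hf fun z hz => ?_
  have hg : ((∏ y ∈ Z.erase z, (X - C y) : F[X])).degree < Z.card := by
    rw [degree_prod]
    simp only [degree_X_sub_C, Finset.sum_const, Finset.card_erase_of_mem hz, nsmul_eq_mul, mul_one]
    have : 0 < Z.card := Finset.card_pos.2 ⟨z, hz⟩
    exact_mod_cast (by omega : Z.card - 1 < Z.card)
  have h0 := map_mul_eq_zero ℓ hfi hg
  rw [hℓ, Finset.sum_eq_single_of_mem z hz] at h0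
  · rw [eval_mul, eval_prod] at h0
    have hne : ∏ y ∈ Z.erase z, eval z (X - C y) ≠ 0 :=
      Finset.prod_ne_zero_iff.2 fun y hy => by
        simpa [sub_eq_zero] using (Finset.ne_of_mem_erase hy).symm
    exact (mul_eq_zero.1 ((mul_eq_zero.1 h0).resolve_left (hw z hz))).resolve_right hne
  · intro y hy hyz
    rw [eval_mul, eval_prod, Finset.prod_eq_zero (Finset.mem_erase.2 ⟨hyz, hy⟩) (by simp)]
    simp

/-- The polynomial `∏ (X - y)` over `Z` is a nonzero kernel element. -/
theorem hankelDet_eq_zero_of_card_lt {ℓ : F[X] →ₗ[F] F} {Z : Finset F} {w : F → F}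
    (hℓ : ∀ f, ℓ f = ∑ z ∈ Z, w z * f.eval z) {h : ℕ} (hh : Z.card < h) :
    hankelDet ℓ h = 0 := by
  by_contra hD
  have hm : (∏ y ∈ Z, (X - C y) : F[X]).Monic := monic_prod_of_monic _ _ fun y _ => monic_X_sub_C y
  refine hm.ne_zero ((hankelDet_ne_zero_iff ℓ h).1 hD _ ?_ fun i _ => ?_)
  · rw [degree_prod]
    simp only [degree_X_sub_C, Finset.sum_const, nsmul_eq_mul, mul_one]
    exact_mod_cast hh
  · rw [hℓ]
    refine Finset.sum_eq_zero fun z hz => ?_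
    rw [eval_mul, eval_prod, Finset.prod_eq_zero hz (by simp)]
    simp

end PointFunctional

/-! ### Complex roots, Tarski queries and the Hermite form -/

section Hermite

variable {R : Type*} [Field R] [LinearOrder R]

/-- A real polynomial viewed as a polynomial over `R(i)`. -/
noncomputable abbrev Polynomial.toCx (f : R[X]) : (Cx R)[X] := f.map (algebraMap R (Cx R))

variable [IsStrictOrderedRing R]

/-- The distinct roots of `P` in `R(i)`. -/
noncomputable def cxRoots (P : R[X]) : Finset (Cx R) := P.toCx.roots.toFinset

/-- The roots of `P` in `R(i)` at which `B` does not vanish. -/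
noncomputable def cxSupport (P B : R[X]) : Finset (Cx R) :=
  (cxRoots P).filter fun z => B.toCx.eval z ≠ 0

/-- The Tarski query of `B` for `P`. -/
noncomputable def tarskiQuery (P B : R[X]) : ℤ :=
  ∑ x ∈ P.roots.toFinset, (SignType.sign (B.eval x) : ℤ)

theorem mem_cxRoots {P : R[X]} (hP : P ≠ 0) {z : Cx R} : z ∈ cxRoots P ↔ P.toCx.eval z = 0 := by
  rw [cxRoots, Multiset.mem_toFinset, mem_roots (Polynomial.map_ne_zero hP), IsRoot]

theorem card_cxRoots_le (P : R[X]) : (cxRoots P).card ≤ P.natDegree := by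
  refine (Multiset.toFinset_card_le _).trans ((card_roots' _).trans ?_)
  rw [natDegree_map]

omit [LinearOrder R] [IsStrictOrderedRing R] in
theorem toCx_eval_algebraMap (f : R[X]) (x : R) :
    f.toCx.eval (algebraMap R (Cx R) x) = algebraMap R (Cx R) (f.eval x) := by
  rw [eval_map_algebraMap, aeval_algebraMap_apply, coe_aeval_eq_eval]

theorem toCx_eval_star (f : R[X]) (z : Cx R) : f.toCx.eval (star z) = star (f.toCx.eval z) := by
  have hc : (starRingEnd (Cx R)).comp (algebraMap R (Cx R)) = algebraMap R (Cx R) := by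
    ext x <;> simp [starRingEnd_apply]
  rw [eval_map, eval_map]
  have := hom_eval₂ f (algebraMap R (Cx R)) (starRingEnd (Cx R)) z
  rw [hc] at this
  exact this.symm

omit [LinearOrder R] [IsStrictOrderedRing R] in
theorem Cx.algebraMap_re {z : Cx R} (hz : z.im = 0) : algebraMap R (Cx R) z.re = z := by
  ext <;> simp [hz]

omit [LinearOrder R] [IsStrictOrderedRing R] in
theorem Cx.star_star (z : Cx R) : star (star z) = z := by
  ext <;> simp

theorem Cx.re_natCast_mul (n : ℕ) (z : Cx R) : ((n : Cx R) * z).re = n * z.re := by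
  simp

theorem star_mem_cxSupport {P B : R[X]} (hP : P ≠ 0) {z : Cx R} (hz : z ∈ cxSupport P B) :
    star z ∈ cxSupport P B := by
  rw [cxSupport, Finset.mem_filter, mem_cxRoots hP] at hz ⊢
  rw [toCx_eval_star, toCx_eval_star, hz.1]
  exact ⟨star_zero _, star_ne_zero.2 hz.2⟩

theorem Finset.card_filter_im_neg {s : Finset (Cx R)} (hs : ∀ z ∈ s, star z ∈ s) :
    (s.filter fun z => z.im < 0).card = (s.filter fun z => 0 < z.im).card := by
  refine Finset.card_bij' (fun z _ => star z) (fun z _ => star z) ?_ ?_ ?_ ?_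
  · intro z hz
    rw [Finset.mem_filter] at hz ⊢
    exact ⟨hs z hz.1, by simpa using hz.2⟩
  · intro z hz
    rw [Finset.mem_filter] at hz ⊢
    exact ⟨hs z hz.1, by simpa using hz.2⟩
  · intro z _; exact Cx.star_star z
  · intro z _; exact Cx.star_star z

theorem Finset.card_eq_real_add_two_mul {s : Finset (Cx R)} (hs : ∀ z ∈ s, star z ∈ s) :
    s.card = (s.filter fun z => z.im = 0).card + 2 * (s.filter fun z => 0 < z.im).card := by
  have h1 := Finset.card_filter_add_card_filter_not (s := s) (fun z : Cx R => z.im = 0)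
  have h2 := Finset.card_filter_add_card_filter_not (s := s.filter fun z => ¬ z.im = 0)
    (fun z : Cx R => 0 < z.im)
  rw [Finset.filter_filter, Finset.filter_filter] at h2
  have e1 : (s.filter fun z => ¬ z.im = 0 ∧ 0 < z.im) = s.filter fun z => 0 < z.im :=
    Finset.filter_congr fun z _ => ⟨fun h => h.2, fun h => ⟨h.ne', h⟩⟩
  have e2 : (s.filter fun z => ¬ z.im = 0 ∧ ¬ 0 < z.im) = s.filter fun z => z.im < 0 :=
    Finset.filter_congr fun z _ => ⟨fun h => lt_of_le_of_ne (not_lt.1 h.2) h.1,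
      fun h => ⟨h.ne, h.not_gt⟩⟩
  rw [e1, e2, Finset.card_filter_im_neg hs] at h2
  omega

theorem card_real_roots_filter {P : R[X]} (hP : P ≠ 0) (p : Cx R → Prop) [DecidablePred p] :
    ((cxRoots P).filter fun z => p z ∧ z.im = 0).card =
      (P.roots.toFinset.filter fun x => p (algebraMap R (Cx R) x)).card := by
  symm
  refine Finset.card_bij' (fun x _ => algebraMap R (Cx R) x) (fun z _ => z.re) ?_ ?_ ?_ ?_
  · intro x hx
    rw [Finset.mem_filter, Multiset.mem_toFinset, mem_roots hP] at hx
    rw [Finset.mem_filter, mem_cxRoots hP, toCx_eval_algebraMap, hx.1.eq_zero]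
    exact ⟨map_zero _, hx.2, by simp⟩
  · intro z hz
    rw [Finset.mem_filter, mem_cxRoots hP] at hz
    have h := Cx.algebraMap_re hz.2.2
    rw [Finset.mem_filter, Multiset.mem_toFinset, mem_roots hP, h]
    refine ⟨?_, hz.2.1⟩
    have h0 := hz.1
    rw [← h, toCx_eval_algebraMap] at h0
    exact (algebraMap R (Cx R)).injective (h0.trans (map_zero _).symm)
  · intro x _
    simp
  · intro z hz
    rw [Finset.mem_filter] at hz
    exact Cx.algebraMap_re hz.2.2

theorem card_cxSupport {P B : R[X]} (hP : P ≠ 0) : (cxSupport P B).card =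
    (P.roots.toFinset.filter fun x => 0 < B.eval x).card +
    (P.roots.toFinset.filter fun x => B.eval x < 0).card +
    2 * ((cxSupport P B).filter fun z => 0 < z.im).card := by
  rw [Finset.card_eq_real_add_two_mul fun z => star_mem_cxSupport hP]
  congr 1
  rw [cxSupport, Finset.filter_filter, card_real_roots_filter hP]
  rw [← Finset.card_union_of_disjoint, ← Finset.filter_or]
  · congr 1
    refine Finset.filter_congr fun x _ => ?_
    rw [toCx_eval_algebraMap, Ne, FaithfulSMul.algebraMap_eq_zero_iff]
    constructor
    · intro h; exact (lt_or_gt_of_ne h).symm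
    · rintro (h | h)
      · exact h.ne'
      · exact h.ne
  · exact Finset.disjoint_filter.2 fun x _ h1 h2 => absurd h1 h2.not_gt

omit [IsStrictOrderedRing R] in
theorem tarskiQuery_eq (P B : R[X]) : tarskiQuery P B =
    (P.roots.toFinset.filter fun x => 0 < B.eval x).card -
    (P.roots.toFinset.filter fun x => B.eval x < 0).card := by
  have : ∀ x, (SignType.sign (B.eval x) : ℤ) =
      (if 0 < B.eval x then 1 else 0) - if B.eval x < 0 then 1 else 0 := by
    intro x
    rcases lt_trichotomy (B.eval x) 0 with h | h | h
    · simp [sign_neg h, h, h.not_gt]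
    · simp [h]
    · simp [sign_pos h, h, h.not_gt]
  simp only [tarskiQuery, this, Finset.sum_sub_distrib, Finset.sum_boole]

variable [IsRealClosed R]

theorem hermiteFunctional_toCx {P : R[X]} (hP : P.Monic) (B : R[X]) (f : (Cx R)[X]) :
    hermiteFunctional P.toCx B.toCx f = ∑ z ∈ cxSupport P B,
      ((P.toCx.rootMultiplicity z : Cx R) * B.toCx.eval z) * f.eval z := by
  rw [hermiteFunctional_apply, modTrace_eq_sum_roots (hP.map _), cxSupport, Finset.sum_filter]
  refine Finset.sum_congr rfl fun z _ => ?_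
  rw [eval_mul, mul_assoc]
  split_ifs with h
  · rfl
  · rw [not_not.1 h]; ring

/-- Over `R(i)` the functional is a sum of evaluations with weights multiplicity times `B(z)`,
nonzero in characteristic zero. Together with the vanishing at larger orders, this makes the size of
the support the order of the last nonzero minor. -/
theorem hankelDet_cxSupport_ne_zero {P : R[X]} (hP : P.Monic) (B : R[X]) :
    hankelDet (hermiteFunctional P B) (cxSupport P B).card ≠ 0 := by
  have hP0 : P.toCx ≠ 0 := (hP.map _).ne_zero
  intro h
  refine hankelDet_card_ne_zero (hermiteFunctional_toCx hP B) (fun z hz => ?_) ?_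
  · rw [cxSupport, Finset.mem_filter, mem_cxRoots hP.ne_zero] at hz
    have := (rootMultiplicity_pos hP0).2 hz.1
    have : CharZero (Cx R) := charZero_of_injective_algebraMap (algebraMap R (Cx R)).injective
    exact mul_ne_zero (by exact_mod_cast (by omega)) hz.2
  · rw [← map_hankelDet _ hP, h, map_zero]

theorem hankelDet_eq_zero_of_cxSupport_lt {P : R[X]} (hP : P.Monic) (B : R[X]) {h : ℕ}
    (hh : (cxSupport P B).card < h) : hankelDet (hermiteFunctional P B) h = 0 := by
  apply (algebraMap R (Cx R)).injective
  rw [map_hankelDet _ hP, map_zero]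
  exact hankelDet_eq_zero_of_card_lt (hermiteFunctional_toCx hP B) hh

theorem hermiteFunctional_re {P : R[X]} (hP : P.Monic) (B f : R[X]) :
    hermiteFunctional P B f = ∑ z ∈ cxSupport P B,
      (P.toCx.rootMultiplicity z : R) * (B.toCx.eval z * f.toCx.eval z).re := by
  have h := congrArg (QuadraticAlgebra.reₗ (R := R) (-1) 0)
    ((map_hermiteFunctional (algebraMap R (Cx R)) hP B f).trans (hermiteFunctional_toCx hP B _))
  rw [map_sum] at h
  refine Eq.trans ?_ (h.trans (Finset.sum_congr rfl fun z _ => ?_))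
  · simp
  · rw [mul_assoc, ← Cx.re_natCast_mul]
    rfl

/-- A real linear form on `R(i)` on whose kernel `w ↦ Re (q w ^ 2)` is nonpositive. -/
noncomputable def Cx.isotropicForm (q : Cx R) : Cx R →ₗ[R] R :=
  if q.re ≤ 0 then QuadraticAlgebra.imₗ (-1) 0 else QuadraticAlgebra.reₗ (-1) 0

omit [IsRealClosed R] in
theorem Cx.re_mul_sq_nonpos {q w : Cx R} (h : Cx.isotropicForm q w = 0) :
    (q * (w * w)).re ≤ 0 := by
  rw [Cx.isotropicForm] at h
  split_ifs at h with hq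
  · have h' : w.im = 0 := h
    simp [h']
    exact mul_nonpos_of_nonpos_of_nonneg hq (mul_self_nonneg _)
  · have h' : w.re = 0 := h
    simp [h']
    exact mul_nonneg (not_le.1 hq).le (mul_self_nonneg _)

/-- The form is nonpositive on the `f` that vanish at the real roots with `B > 0` and satisfy one
real linear condition at each root of the upper half-plane. The positive index is at most the
codimension of this subspace. -/
theorem sigPos_hermite_le {P : R[X]} (hP : P.Monic) (B : R[X]) (d : ℕ) :
    sigPos (hankelForm (hermiteFunctional P B) d) ≤
      (P.roots.toFinset.filter fun x => 0 < B.eval x).card +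
      ((cxSupport P B).filter fun z => 0 < z.im).card := by
  set S := P.roots.toFinset.filter fun x => 0 < B.eval x with hS
  set U := (cxSupport P B).filter fun z => 0 < z.im with hU
  let evC (z : Cx R) : R[X] →ₗ[R] Cx R := (aeval z).toLinearMap
  let Λ : (Fin d → R) →ₗ[R] (S → R) × (U → R) :=
    ((LinearMap.pi fun x : S => leval (x : R)).prod
      (LinearMap.pi fun z : U => (Cx.isotropicForm (B.toCx.eval (z : Cx R))).comp (evC z))).comp
      (ofFn d)
  have hker : ∀ v ∈ LinearMap.ker Λ, hankelForm (hermiteFunctional P B) d v ≤ 0 := by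
    intro v hv
    rw [LinearMap.mem_ker] at hv
    set f := ofFn d v with hf
    have h1 : ∀ x ∈ S, f.eval x = 0 := fun x hx => congrFun (congrArg Prod.fst hv) ⟨x, hx⟩
    have h2 : ∀ z ∈ U, Cx.isotropicForm (B.toCx.eval z) (f.toCx.eval z) = 0 := fun z hz => by
      have := congrFun (congrArg Prod.snd hv) ⟨z, hz⟩
      rw [eval_map_algebraMap f]
      exact this
    rw [hankelForm_apply, ← hf, hermiteFunctional_re hP]
    refine Finset.sum_nonpos fun z hz => mul_nonpos_of_nonneg_of_nonpos (Nat.cast_nonneg _) ?_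
    rw [show (f * f).toCx = f.toCx * f.toCx from Polynomial.map_mul _, eval_mul]
    rcases lt_trichotomy z.im 0 with him | him | him
    · have hz' : star z ∈ U := Finset.mem_filter.2
        ⟨star_mem_cxSupport hP.ne_zero hz, by simpa using him⟩
      have := Cx.re_mul_sq_nonpos (h2 _ hz')
      rwa [toCx_eval_star, toCx_eval_star, ← star_mul', ← star_mul', QuadraticAlgebra.re_star,
        zero_mul, add_zero] at this
    · have hzr := Cx.algebraMap_re him
      rw [← hzr, toCx_eval_algebraMap, toCx_eval_algebraMap, ← map_mul, ← map_mul,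
        QuadraticAlgebra.algebraMap_re]
      by_cases hB : 0 < B.eval z.re
      · have hzS : z.re ∈ S := by
          rw [cxSupport, Finset.mem_filter, mem_cxRoots hP.ne_zero, ← hzr,
            toCx_eval_algebraMap, FaithfulSMul.algebraMap_eq_zero_iff] at hz
          rw [hS, Finset.mem_filter, Multiset.mem_toFinset, mem_roots hP.ne_zero]
          exact ⟨hz.1, hB⟩
        simp [h1 _ hzS]
      · exact mul_nonpos_of_nonpos_of_nonneg (not_lt.1 hB) (mul_self_nonneg _)
    · exact Cx.re_mul_sq_nonpos (h2 z (Finset.mem_filter.2 ⟨hz, him⟩))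
  have hle := QuadraticForm.sigPos_add_finrank_le_of_nonpos hker
  have hrk := LinearMap.finrank_range_add_finrank_ker Λ
  have hr := Submodule.finrank_le (LinearMap.range Λ)
  rw [Module.finrank_prod, Module.finrank_fintype_fun_eq_card, Module.finrank_fintype_fun_eq_card,
    Fintype.card_coe, Fintype.card_coe] at hr
  omega

omit [LinearOrder R] [IsStrictOrderedRing R] [IsRealClosed R] in
theorem hermiteFunctional_neg (P B : R[X]) :
    hermiteFunctional P (-B) = -hermiteFunctional P B := by
  ext f
  simp [hermiteFunctional_apply]

omit [IsRealClosed R] in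
theorem cxSupport_neg (P B : R[X]) : cxSupport P (-B) = cxSupport P B := by
  simp [cxSupport]

/-- **Hermite's theorem**. -/
theorem hermite_signature {P : R[X]} (hP : P.Monic) (B : R[X]) :
    (sigPos (hankelForm (hermiteFunctional P B) (cxSupport P B).card) : ℤ) -
      sigNeg (hankelForm (hermiteFunctional P B) (cxSupport P B).card) = tarskiQuery P B := by
  -- The bounds for `B` and `-B` limit both indices. Their sum is the size of the support, which is
  -- also the sum of the indices, so both bounds are equalities and the complex pairs cancel in the
  -- difference.
  have h1 := sigPos_hermite_le hP B (cxSupport P B).card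
  have h2 := sigPos_hermite_le hP (-B) (cxSupport P B).card
  rw [hermiteFunctional_neg, hankelForm_neg, sigPos_neg, cxSupport_neg] at h2
  simp only [eval_neg, neg_pos] at h2
  have h3 := (hankelForm_signature _ (hankelDet_cxSupport_ne_zero hP B)).1
  have h4 := card_cxSupport (B := B) hP.ne_zero
  rw [tarskiQuery_eq]
  omega

/-- The signs of the leading principal minors of the Hermite matrix determine the number of
complex roots at which `B` does not vanish, and the Tarski query of `B`. -/
theorem card_cxSupport_and_tarskiQuery_eq {P₁ P₂ B₁ B₂ : R[X]} (hP₁ : P₁.Monic) (hP₂ : P₂.Monic)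
    {p : ℕ} (hp₁ : P₁.natDegree = p) (hp₂ : P₂.natDegree = p)
    (hs : ∀ r, 1 ≤ r → r ≤ p → SignType.sign (hankelDet (hermiteFunctional P₁ B₁) r) =
      SignType.sign (hankelDet (hermiteFunctional P₂ B₂) r)) :
    (cxSupport P₁ B₁).card = (cxSupport P₂ B₂).card ∧
      tarskiQuery P₁ B₁ = tarskiQuery P₂ B₂ := by
  have hs' : ∀ r ≤ p, SignType.sign (hankelDet (hermiteFunctional P₁ B₁) r) =
      SignType.sign (hankelDet (hermiteFunctional P₂ B₂) r) := by
    intro r hr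
    rcases Nat.eq_zero_or_pos r with rfl | h
    · rw [hankelDet, hankelDet, Matrix.det_isEmpty, Matrix.det_isEmpty]
    · exact hs r h hr
  have hle : ∀ {P B : R[X]}, P.natDegree = p → (cxSupport P B).card ≤ p := fun h =>
    (Finset.card_filter_le _ _).trans (h ▸ card_cxRoots_le _)
  have hz : ∀ r ≤ p, (hankelDet (hermiteFunctional P₁ B₁) r = 0 ↔
      hankelDet (hermiteFunctional P₂ B₂) r = 0) := fun r hr => by
    rw [← sign_eq_zero_iff, hs' r hr, sign_eq_zero_iff]
  have hcard : (cxSupport P₁ B₁).card = (cxSupport P₂ B₂).card := by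
    refine le_antisymm (le_of_not_gt fun h => ?_) (le_of_not_gt fun h => ?_)
    · exact hankelDet_cxSupport_ne_zero hP₁ B₁ ((hz _ (hle hp₁)).2
        (hankelDet_eq_zero_of_cxSupport_lt hP₂ B₂ h))
    · exact hankelDet_cxSupport_ne_zero hP₂ B₂ ((hz _ (hle hp₂)).1
        (hankelDet_eq_zero_of_cxSupport_lt hP₁ B₁ h))
  obtain ⟨h1, h2⟩ := signature_eq_of_sign_hankelDet_eq _ _
    (fun h hh => hs' h (hh.trans (hle hp₁))) (hankelDet_cxSupport_ne_zero hP₁ B₁)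
  refine ⟨hcard, ?_⟩
  rw [← hermite_signature hP₁, ← hermite_signature hP₂, h1, h2, hcard]

end Hermite

/-! ### Sign vectors are determined by their low-order moments -/

section Moments

/-- Quadratic interpolation on `{-1, 0, 1}`; the factor 2 clears the denominator of `(x² ± x) / 2`.
-/
theorem SignType.exists_indicator (t : SignType) (n : ℕ) : ∃ c₀ c₁ c₂ : ℤ, ∀ x : SignType,
    (if x = t then 2 * (x : ℤ) ^ n else 0) = c₀ + c₁ * (x : ℤ) + c₂ * (x : ℤ) ^ 2 := by
  have h1 : ((1 : SignType) : ℤ) = 1 := rfl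
  have h2 : ((-1 : SignType) : ℤ) = -1 := rfl
  have h3 : ((0 : SignType) : ℤ) = 0 := rfl
  rcases SignType.trichotomy t with rfl | rfl | rfl
  · refine ⟨0, -(-1) ^ n, (-1) ^ n, fun x => ?_⟩
    rcases SignType.trichotomy x with rfl | rfl | rfl <;> simp [h1, h2, h3, two_mul]
  · refine ⟨2 * 0 ^ n, 0, -(2 * 0 ^ n), fun x => ?_⟩
    rcases SignType.trichotomy x with rfl | rfl | rfl <;> simp [h1, h2, h3]
  · refine ⟨0, 1, 1, fun x => ?_⟩
    rcases SignType.trichotomy x with rfl | rfl | rfl <;> simp [h1, h2, h3]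

variable {ι : Type*} [Fintype ι] [DecidableEq ι]

/-- The moment `∑ f(σ) σ^a`. -/
def signMoment (f : (ι → SignType) → ℤ) (a : ι → ℕ) : ℤ :=
  ∑ σ, f σ * ∏ i, (σ i : ℤ) ^ a i

/-- The indicator of `σ s = t` is a quadratic polynomial in `σ s`. A moment of the slice is thus a
combination of moments of `f` with the exponent at `s` replaced by 0, 1, 2, which costs at most one
more coordinate. -/
theorem signMoment_restrict_eq_zero {ℓ : ℕ} {f : (ι → SignType) → ℤ}
    (hm : ∀ a : ι → ℕ, (∀ i, a i ≤ 2) → (Finset.univ.filter fun i => a i ≠ 0).card ≤ ℓ + 1 →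
      signMoment f a = 0) (s : ι) (t : SignType) {a : ι → ℕ} (ha : ∀ i, a i ≤ 2)
    (hc : (Finset.univ.filter fun i => a i ≠ 0).card ≤ ℓ) :
    signMoment (fun σ => if σ s = t then f σ else 0) a = 0 := by
  obtain ⟨c₀, c₁, c₂, hc'⟩ := SignType.exists_indicator t (a s)
  have hupd : ∀ j ≤ 2, signMoment f (Function.update a s j) = 0 := by
    intro j hj
    refine hm _ (fun i => ?_) ?_
    · by_cases h : i = s
      · subst h; simpa using hj
      · simpa [h] using ha i
    · refine le_trans (Finset.card_le_card (t := insert s (Finset.univ.filter fun i => a i ≠ 0))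
        fun i hi => ?_) ((Finset.card_insert_le _ _).trans (by omega))
      by_cases h : i = s
      · simp [h]
      · simpa [h] using hi
  have hprod : ∀ (σ : ι → SignType) (b : ι → ℕ),
      ∏ i, (σ i : ℤ) ^ b i = (σ s : ℤ) ^ b s * ∏ i ∈ Finset.univ.erase s, (σ i : ℤ) ^ b i :=
    fun σ b => (Finset.mul_prod_erase _ _ (Finset.mem_univ s)).symm
  have hprod' : ∀ (σ : ι → SignType) (j : ℕ), ∏ i, (σ i : ℤ) ^ (Function.update a s j) i =
      (σ s : ℤ) ^ j * ∏ i ∈ Finset.univ.erase s, (σ i : ℤ) ^ a i := by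
    intro σ j
    rw [hprod]
    congr 1
    · simp
    · refine Finset.prod_congr rfl fun i hi => ?_
      rw [Function.update_of_ne (Finset.ne_of_mem_erase hi)]
  have key : 2 * signMoment (fun σ => if σ s = t then f σ else 0) a =
      c₀ * signMoment f (Function.update a s 0) + c₁ * signMoment f (Function.update a s 1) +
        c₂ * signMoment f (Function.update a s 2) := by
    simp only [signMoment, hprod', Finset.mul_sum, ← Finset.sum_add_distrib]
    refine Finset.sum_congr rfl fun σ _ => ?_
    rw [hprod]
    have h := hc' (σ s)
    split_ifs at h ⊢ with hst
    · linear_combination (f σ * ∏ i ∈ Finset.univ.erase s, (σ i : ℤ) ^ a i) * h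
    · linear_combination (f σ * ∏ i ∈ Finset.univ.erase s, (σ i : ℤ) ^ a i) * h
  rw [hupd 0 (by omega), hupd 1 (by omega), hupd 2 le_rfl] at key
  omega

/-- The zeroth moment forces two points in the support of a nonzero function. Slicing along a
coordinate where they differ gives two disjoint nonzero slices, each with vanishing moments of one
order less, so the bound doubles. -/
theorem two_pow_le_card_support {ℓ : ℕ} {f : (ι → SignType) → ℤ} (hf : f ≠ 0)
    (hm : ∀ a : ι → ℕ, (∀ i, a i ≤ 2) → (Finset.univ.filter fun i => a i ≠ 0).card ≤ ℓ →
      signMoment f a = 0) :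
    2 ^ (ℓ + 1) ≤ (Finset.univ.filter fun σ => f σ ≠ 0).card := by
  obtain ⟨σ₁, hσ₁⟩ := Function.ne_iff.1 hf
  simp only [Pi.zero_apply] at hσ₁
  obtain ⟨σ₂, hne, hσ₂⟩ : ∃ σ₂, σ₂ ≠ σ₁ ∧ f σ₂ ≠ 0 := by
    by_contra! hcon
    have h0 := hm 0 (by simp) (by simp)
    simp only [signMoment, Pi.zero_apply, pow_zero, Finset.prod_const_one, mul_one] at h0
    rw [Finset.sum_eq_single σ₁ (fun σ _ h => hcon σ h) (by simp)] at h0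
    exact hσ₁ h0
  induction ℓ generalizing f σ₁ σ₂ with
  | zero =>
    rw [zero_add, pow_one, ← Finset.card_pair hne]
    refine Finset.card_le_card fun σ hσ => ?_
    rcases Finset.mem_insert.1 hσ with rfl | h
    · simpa using hσ₂
    · rw [Finset.mem_singleton.1 h]; simpa using hσ₁
  | succ ℓ ih =>
    obtain ⟨s, hs⟩ := Function.ne_iff.1 hne
    have step : ∀ t, (∃ σ, σ s = t ∧ f σ ≠ 0) → 2 ^ (ℓ + 1) ≤
        (Finset.univ.filter fun σ => (if σ s = t then f σ else 0) ≠ 0).card := by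
      rintro t ⟨σ, hσ, hσf⟩
      have hm' : ∀ a : ι → ℕ, (∀ i, a i ≤ 2) → (Finset.univ.filter fun i => a i ≠ 0).card ≤ ℓ →
          signMoment (fun σ => if σ s = t then f σ else 0) a = 0 := fun a ha hc =>
        signMoment_restrict_eq_zero hm s t ha hc
      have hf' : (fun σ => if σ s = t then f σ else 0) ≠ 0 := by
        refine Function.ne_iff.2 ⟨σ, ?_⟩
        simpa [hσ] using hσf
      obtain ⟨τ, hτ, hτf⟩ : ∃ τ, τ ≠ σ ∧ (if τ s = t then f τ else 0) ≠ 0 := by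
        by_contra! hcon
        have h0 := hm' 0 (by simp) (by simp)
        simp only [signMoment, Pi.zero_apply, pow_zero, Finset.prod_const_one, mul_one] at h0
        rw [Finset.sum_eq_single σ (fun σ _ h => hcon σ h) (by simp)] at h0
        exact hσf (by simpa [hσ] using h0)
      exact ih hf' hm' σ (by simpa [hσ] using hσf) τ hτ hτf
    have h1 := step _ ⟨σ₁, rfl, hσ₁⟩
    have h2 := step _ ⟨σ₂, rfl, hσ₂⟩
    have hdisj : Disjoint (Finset.univ.filter fun σ => (if σ s = σ₁ s then f σ else 0) ≠ 0)
        (Finset.univ.filter fun σ => (if σ s = σ₂ s then f σ else 0) ≠ 0) := by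
      refine Finset.disjoint_filter.2 fun σ _ ha hb => ?_
      simp only [ne_eq, ite_eq_right_iff, Classical.not_imp] at ha hb
      exact hs (hb.1.symm.trans ha.1)
    have hsub := Finset.card_le_card (Finset.union_subset
      (s := Finset.univ.filter fun σ => (if σ s = σ₁ s then f σ else 0) ≠ 0)
      (t := Finset.univ.filter fun σ => (if σ s = σ₂ s then f σ else 0) ≠ 0)
      (u := Finset.univ.filter fun σ => f σ ≠ 0)
      (fun σ hσ => by
        simp only [Finset.mem_filter, ne_eq, ite_eq_right_iff, Classical.not_imp] at hσ ⊢
        exact ⟨hσ.1, hσ.2.2⟩)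
      (fun σ hσ => by
        simp only [Finset.mem_filter, ne_eq, ite_eq_right_iff, Classical.not_imp] at hσ ⊢
        exact ⟨hσ.1, hσ.2.2⟩))
    rw [Finset.card_union_of_disjoint hdisj] at hsub
    rw [pow_succ]
    omega

theorem sum_card_fiber_mul {X : Type*} (Z : Finset X) (e : X → ι → SignType)
    (g : (ι → SignType) → ℤ) :
    ∑ σ, ((Z.filter fun z => e z = σ).card : ℤ) * g σ = ∑ z ∈ Z, g (e z) := by
  rw [← Finset.sum_fiberwise' Z e g]
  simp

/-- Two families of at most `n` sign vectors whose moments of support at most `Nat.size n` agree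
have the same fibre cardinalities. -/
theorem card_filter_eq_of_moments {X Y : Type*} {Z₁ : Finset X} {Z₂ : Finset Y}
    (e₁ : X → ι → SignType) (e₂ : Y → ι → SignType) {n : ℕ} (h₁ : Z₁.card ≤ n) (h₂ : Z₂.card ≤ n)
    (hm : ∀ a : ι → ℕ, (∀ i, a i ≤ 2) →
      (Finset.univ.filter fun i => a i ≠ 0).card ≤ Nat.size n →
      ∑ z ∈ Z₁, ∏ i, (e₁ z i : ℤ) ^ a i = ∑ z ∈ Z₂, ∏ i, (e₂ z i : ℤ) ^ a i)
    (σ : ι → SignType) :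
    (Z₁.filter fun z => e₁ z = σ).card = (Z₂.filter fun z => e₂ z = σ).card := by
  classical
  let f : (ι → SignType) → ℤ := fun σ =>
    (Z₁.filter fun z => e₁ z = σ).card - (Z₂.filter fun z => e₂ z = σ).card
  suffices hf : f = 0 by
    have := congrFun hf σ
    simp only [f, Pi.zero_apply, sub_eq_zero] at this
    exact_mod_cast this
  by_contra hf
  have hle := two_pow_le_card_support (ℓ := Nat.size n) hf fun a ha hc => by
    simp only [signMoment, f, sub_mul, Finset.sum_sub_distrib]
    rw [sum_card_fiber_mul, sum_card_fiber_mul, hm a ha hc, sub_self]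
  have hsub : (Finset.univ.filter fun σ => f σ ≠ 0) ⊆ Z₁.image e₁ ∪ Z₂.image e₂ := by
    intro σ hσ
    by_contra hcon
    simp only [Finset.mem_union, Finset.mem_image, not_or, not_exists, not_and] at hcon
    have a1 : (Z₁.filter fun z => e₁ z = σ) = ∅ := Finset.filter_eq_empty_iff.2 fun {z} => hcon.1 z
    have a2 : (Z₂.filter fun z => e₂ z = σ) = ∅ := Finset.filter_eq_empty_iff.2 fun {z} => hcon.2 z
    simp [f, a1, a2] at hσ
  have hcard := (Finset.card_le_card hsub).trans (Finset.card_union_le _ _)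
  have i1 := Finset.card_image_le (s := Z₁) (f := e₁)
  have i2 := Finset.card_image_le (s := Z₂) (f := e₂)
  -- `n < 2 ^ size n`, so `2 ^ (size n + 1)` exceeds `2n`, the largest possible size of the support.
  have := Nat.lt_size_self n
  rw [pow_succ] at hle
  omega

theorem card_filter_comp_eq {X Y T : Type*} [DecidableEq T] {Z₁ : Finset X} {Z₂ : Finset Y}
    {e₁ : X → T} {e₂ : Y → T} [Fintype T]
    (h : ∀ σ, (Z₁.filter fun z => e₁ z = σ).card = (Z₂.filter fun z => e₂ z = σ).card)
    (p : T → Prop) [DecidablePred p] :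
    (Z₁.filter fun z => p (e₁ z)).card = (Z₂.filter fun z => p (e₂ z)).card := by
  rw [Finset.card_eq_sum_card_fiberwise (f := e₁) (t := Finset.univ) (by simp),
    Finset.card_eq_sum_card_fiberwise (f := e₂) (t := Finset.univ) (by simp)]
  refine Finset.sum_congr rfl fun σ _ => ?_
  rw [Finset.filter_filter, Finset.filter_filter]
  by_cases hσ : p σ
  · convert h σ using 2 <;> ext z <;> simp only [Finset.mem_filter] <;> constructor <;>
      rintro ⟨h1, h2⟩
    · exact ⟨h1, h2.2⟩
    · exact ⟨h1, h2 ▸ hσ, h2⟩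
    · exact ⟨h1, h2.2⟩
    · exact ⟨h1, h2 ▸ hσ, h2⟩
  · have e : ∀ {t : T}, ¬ (p t ∧ t = σ) := fun h1 => hσ (h1.2 ▸ h1.1)
    rw [Finset.filter_false_of_mem fun z _ => e, Finset.filter_false_of_mem fun z _ => e,
      Finset.card_empty, Finset.card_empty]

end Moments

/-! ### Root data of a monic polynomial over a real closed field -/

section Mu

/-- The multiplicity read off from the vanishing of the derivatives. -/
theorem DerSign.mu_eq_rootMultiplicity {F : Type*} [Field F] [CharZero F] {f : F[X]}
    (hf : f ≠ 0) {p : ℕ} (hp : f.natDegree = p) {z : F} {η : DerSign p}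
    (h : ∀ i ≤ p, η.plus i ≠ 0 ↔ (derivative^[i] f).eval z ≠ 0) :
    η.mu = f.rootMultiplicity z := by
  classical
  have hle : f.rootMultiplicity z ≤ p := by
    rw [← hp, ← count_roots]
    exact (Multiset.count_le_card _ _).trans (card_roots' _)
  have hlow : ∀ i < f.rootMultiplicity z, (derivative^[i] f).eval z = 0 := fun i hi =>
    (lt_rootMultiplicity_iff_isRoot_iterate_derivative hf).1 hi i le_rfl
  refine IsLeast.csInf_eq ⟨?_, fun i hi => ?_⟩
  · show η.plus (f.rootMultiplicity z) ≠ 0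
    rw [h _ hle]
    intro h0
    refine lt_irrefl _ ((lt_rootMultiplicity_iff_isRoot_iterate_derivative hf
      (n := f.rootMultiplicity z)).2 fun i hi => ?_)
    rcases hi.eq_or_lt with rfl | hlt
    · exact h0
    · exact hlow i hlt
  · by_contra hlt
    rw [not_le] at hlt
    exact (h i (by omega)).1 hi (hlow i hlt)

variable {R : Type*} [Field R] [LinearOrder R] [IsStrictOrderedRing R]

theorem thomEncoding_mu {f : R[X]} (hf : f.Monic) {p : ℕ} (hp : f.natDegree = p) (hp1 : 1 ≤ p)
    {x : R} (hx : f.eval x = 0) : (thomEncoding p f x).mu = f.rootMultiplicity x := by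
  subst hp
  refine DerSign.mu_eq_rootMultiplicity hf.ne_zero rfl fun i hi => ?_
  rw [thomEncoding_plus hf hp1 hx hi, sign_ne_zero]

/-- The vanishing pattern of the derivatives at a complex point. -/
noncomputable def cxPattern (p : ℕ) (f : R[X]) (z : Cx R) : DerSign p :=
  fun h => if (derivative^[(h : ℕ)] f).toCx.eval z = 0 then 0 else 1

theorem cxPattern_mu {f : R[X]} (hf : f.Monic) {p : ℕ} (hp : f.natDegree = p) (hp1 : 1 ≤ p)
    {z : Cx R} (hz : f.toCx.eval z = 0) : (cxPattern p f z).mu = f.toCx.rootMultiplicity z := by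
  have : CharZero (Cx R) := charZero_of_injective_algebraMap (algebraMap R (Cx R)).injective
  have hfc : f.toCx.Monic := hf.map _
  have hpc : f.toCx.natDegree = p := by rw [natDegree_map, hp]
  refine DerSign.mu_eq_rootMultiplicity hfc.ne_zero hpc fun i hi => ?_
  rcases hi.eq_or_lt with rfl | hlt
  · rw [DerSign.plus_self]
    conv_rhs => rw [← hpc]
    rw [hfc.iterate_derivative_natDegree, eval_C]
    simp [Nat.factorial_ne_zero]
  rcases Nat.eq_zero_or_pos i with rfl | hpos
  · simp [DerSign.plus_zero hp1, hz]
  · rw [DerSign.plus_of_mem _ (Finset.mem_Ico.2 ⟨hpos, hlt⟩), iterate_derivative_map]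
    simp [cxPattern]

end Mu

section Ext

/-- A list sorted for an asymmetric or antisymmetric relation is determined by its multiset of
entries, and the real multiplicities are read off from the encodings. -/
theorem ThomData.eq_of_forall {p : ℕ} {D D' : ThomData p}
    (h₁ : ∀ η, (∃ j, D.enc j = η) ↔ ∃ j, D'.enc j = η)
    (hm : ∀ j, D.mult j = (D.enc j).mu) (hm' : ∀ j, D'.mult j = (D'.enc j).mu)
    (h₂ : ∀ m, (Finset.univ.filter fun k => D.cmult k = m).card =
      (Finset.univ.filter fun k => D'.cmult k = m).card) : D = D' := by
  have henc : List.ofFn D.enc = List.ofFn D'.enc := by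
    refine List.Perm.eq_of_pairwise (le := DerSign.MuPrec) ?_ ?_ ?_ ?_
    · intro a b _ _ hab hba
      exact absurd hba hab.asymm
    · exact List.pairwise_ofFn.2 fun i j hij => D.enc_ordered i j hij
    · exact List.pairwise_ofFn.2 fun i j hij => D'.enc_ordered i j hij
    · refine (List.perm_ext_iff_of_nodup (List.nodup_ofFn.2 D.enc_injective)
        (List.nodup_ofFn.2 D'.enc_injective)).2 fun η => ?_
      rw [List.mem_ofFn, List.mem_ofFn]
      exact h₁ η
  have hc : List.ofFn D.cmult = List.ofFn D'.cmult := by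
    refine List.Perm.eq_of_pairwise (le := (· ≥ ·)) ?_ ?_ ?_ ?_
    · intro a b _ _ hab hba
      exact le_antisymm hba hab
    · exact List.pairwise_ofFn.2 fun i j hij => D.cmult_antitone hij.le
    · exact List.pairwise_ofFn.2 fun i j hij => D'.cmult_antitone hij.le
    · rw [← Multiset.coe_eq_coe, ← Fin.univ_val_map, ← Fin.univ_val_map]
      ext m
      rw [Multiset.count_map, Multiset.count_map]
      have h := h₂ m
      simp only [eq_comm (b := m)] at h
      exact h
  rw [List.ofFn_inj'] at henc hc
  obtain ⟨r, s, mult, cmult, enc, _, _, _, _, _, _, _⟩ := D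
  obtain ⟨r', s', mult', cmult', enc', _, _, _, _, _, _, _⟩ := D'
  simp only at henc hc hm hm'
  obtain ⟨rfl, henc⟩ := Sigma.mk.inj_iff.1 henc
  obtain ⟨rfl, hc⟩ := Sigma.mk.inj_iff.1 hc
  obtain rfl := eq_of_heq henc
  obtain rfl := eq_of_heq hc
  obtain rfl : mult = mult' := funext fun j => (hm j).trans (hm' j).symm
  rfl

end Ext

/-! ### Factorization systems and root multiplicities -/

section Fact

variable {R : Type*} [Field R] [LinearOrder R] [IsStrictOrderedRing R]

theorem IsFact.toCx_eq {f : R[X]} {r s : ℕ} {μ : Fin r → ℕ} {ν : Fin s → ℕ} {θ : Fin r → R}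
    {α β : Fin s → R} (h : IsFact f μ ν θ α β) :
    f.toCx = (∏ j, (X - C (algebraMap R (Cx R) (θ j))) ^ μ j) *
      ∏ k, ((X - C (⟨α k, β k⟩ : Cx R)) * (X - C (star ⟨α k, β k⟩))) ^ ν k := by
  rw [h.eq_prod, Polynomial.toCx, Polynomial.map_mul, Polynomial.map_prod, Polynomial.map_prod]
  congr 1
  · refine Finset.prod_congr rfl fun j _ => ?_
    rw [Polynomial.map_pow, Polynomial.map_sub, map_X, map_C]
  · refine Finset.prod_congr rfl fun k _ => ?_
    rw [Polynomial.map_pow, ← quadFactor_map]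

theorem Polynomial.rootMultiplicity_prod_pow {F : Type*} [Field F] [DecidableEq F] {ι : Type*}
    (s : Finset ι) (n : ι → ℕ) (a : ι → F) (w : F) :
    (∏ j ∈ s, (X - C (a j)) ^ n j).rootMultiplicity w = ∑ j ∈ s, if w = a j then n j else 0 := by
  rw [← count_roots, roots_prod _ _ (Finset.prod_ne_zero_iff.2 fun j _ =>
    pow_ne_zero _ (X_sub_C_ne_zero _)), Multiset.count_bind, Finset.sum]
  congr 1
  refine Multiset.map_congr rfl fun j _ => ?_
  rw [roots_pow, roots_X_sub_C, Multiset.count_nsmul, Multiset.count_singleton]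
  split_ifs <;> simp

theorem IsFact.rootMultiplicity_eq {f : R[X]} {r s : ℕ} {μ : Fin r → ℕ} {ν : Fin s → ℕ}
    {θ : Fin r → R} {α β : Fin s → R} (h : IsFact f μ ν θ α β) (w : Cx R) :
    f.toCx.rootMultiplicity w = (∑ j, if w = algebraMap R (Cx R) (θ j) then μ j else 0) +
      ((∑ k, if w = ⟨α k, β k⟩ then ν k else 0) +
        ∑ k, if w = star ⟨α k, β k⟩ then ν k else 0) := by
  have h1 : ∀ {ι : Type} (s : Finset ι) (n : ι → ℕ) (a : ι → Cx R),
      (∏ j ∈ s, (X - C (a j)) ^ n j) ≠ 0 := fun s n a => Finset.prod_ne_zero_iff.2 fun j _ =>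
    pow_ne_zero _ (X_sub_C_ne_zero _)
  rw [h.toCx_eq]
  simp only [mul_pow, Finset.prod_mul_distrib]
  rw [rootMultiplicity_mul (mul_ne_zero (h1 _ _ _) (mul_ne_zero (h1 _ _ _) (h1 _ _ _))),
    rootMultiplicity_mul (mul_ne_zero (h1 _ _ _) (h1 _ _ _)), rootMultiplicity_prod_pow,
    rootMultiplicity_prod_pow, rootMultiplicity_prod_pow]

theorem rootMultiplicity_toCx (f : R[X]) (x : R) :
    f.toCx.rootMultiplicity (algebraMap R (Cx R) x) = f.rootMultiplicity x :=
  (eq_rootMultiplicity_map (algebraMap R (Cx R)).injective x).symm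

theorem rootMultiplicity_toCx_star (f : R[X]) (z : Cx R) :
    f.toCx.rootMultiplicity (star z) = f.toCx.rootMultiplicity z := by
  have hc : (starRingEnd (Cx R)).comp (algebraMap R (Cx R)) = algebraMap R (Cx R) := by
    ext x <;> simp [starRingEnd_apply]
  have := eq_rootMultiplicity_map (p := f.toCx) (f := starRingEnd (Cx R))
    (starRingEnd (Cx R)).injective z
  rw [Polynomial.map_map, hc] at this
  exact this.symm

variable {f : R[X]} {r s : ℕ} {μ : Fin r → ℕ} {ν : Fin s → ℕ} {θ : Fin r → R} {α β : Fin s → R}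

omit [LinearOrder R] [IsStrictOrderedRing R] in
theorem IsFact.theta_injective (h : IsFact f μ ν θ α β) : Function.Injective θ := by
  intro i j hij
  rcases lt_trichotomy i j with hlt | rfl | hlt
  · exact absurd hij (h.real_ne i j hlt)
  · rfl
  · exact absurd hij.symm (h.real_ne j i hlt)

theorem IsFact.rootMultiplicity_real (h : IsFact f μ ν θ α β) (x : R) :
    f.rootMultiplicity x = ∑ j, if x = θ j then μ j else 0 := by
  have h0 : ∀ k, algebraMap R (Cx R) x ≠ ⟨α k, β k⟩ := fun k hk => by
    have := congrArg QuadraticAlgebra.im hk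
    exact h.im_ne k (by simpa using this.symm)
  have h0' : ∀ k, algebraMap R (Cx R) x ≠ star ⟨α k, β k⟩ := fun k hk => by
    have := congrArg QuadraticAlgebra.im hk
    exact h.im_ne k (by simpa using this.symm)
  rw [← rootMultiplicity_toCx, h.rootMultiplicity_eq]
  simp only [h0, h0', (algebraMap R (Cx R)).injective.eq_iff, if_false,
    Finset.sum_const_zero, add_zero]

theorem IsFact.rootMultiplicity_theta (h : IsFact f μ ν θ α β) (j : Fin r) :
    f.rootMultiplicity (θ j) = μ j := by
  rw [h.rootMultiplicity_real]
  simp [h.theta_injective.eq_iff]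

theorem IsFact.eval_theta (h : IsFact f μ ν θ α β) {j : Fin r} (hμ : 0 < μ j) :
    f.eval (θ j) = 0 := by
  by_contra h0
  have := rootMultiplicity_eq_zero (p := f) (x := θ j) h0
  rw [h.rootMultiplicity_theta] at this
  omega

theorem IsFact.exists_theta (h : IsFact f μ ν θ α β) (hf : f ≠ 0) {x : R} (hx : f.eval x = 0) :
    ∃ j, θ j = x := by
  by_contra! hcon
  have h1 := (rootMultiplicity_pos hf).2 hx
  rw [h.rootMultiplicity_real, Finset.sum_eq_zero fun j _ => if_neg (hcon j).symm] at h1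
  exact lt_irrefl _ h1

omit [IsStrictOrderedRing R] in
-- The system leaves the sign of `β k` free; `|β k|` selects the root in the upper half-plane.
-- Coinciding roots would make the resultant vanish.
theorem IsFact.upper_injective (h : IsFact f μ ν θ α β) :
    Function.Injective fun k => (⟨α k, |β k|⟩ : Cx R) := by
  have key : ∀ k l, k < l → (⟨α k, |β k|⟩ : Cx R) ≠ ⟨α l, |β l|⟩ := by
    intro k l hkl he
    have h1 : α k = α l := congrArg QuadraticAlgebra.re he
    have h2 : |β k| = |β l| := congrArg QuadraticAlgebra.im he
    refine h.res_ne k l hkl ?_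
    rw [quadRes, h1]
    rcases abs_eq_abs.1 h2 with h2 | h2 <;> rw [h2] <;> ring
  intro k l he
  rcases lt_trichotomy k l with hlt | rfl | hlt
  · exact absurd he (key k l hlt)
  · rfl
  · exact absurd he.symm (key l k hlt)

theorem IsFact.rootMultiplicity_upper (h : IsFact f μ ν θ α β) {w : Cx R} (hw : 0 < w.im) :
    f.toCx.rootMultiplicity w = ∑ k, if w = ⟨α k, |β k|⟩ then ν k else 0 := by
  have h0 : ∀ j, w ≠ algebraMap R (Cx R) (θ j) := fun j hj => by
    rw [hj] at hw
    simp at hw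
  rw [h.rootMultiplicity_eq, Finset.sum_eq_zero fun j _ => if_neg (h0 j), zero_add,
    ← Finset.sum_add_distrib]
  refine Finset.sum_congr rfl fun k _ => ?_
  rcases lt_or_gt_of_ne (h.im_ne k) with hk | hk
  · have e1 : w ≠ ⟨α k, β k⟩ := fun he => by
      rw [he] at hw
      exact absurd hw hk.not_gt
    have e2 : (star ⟨α k, β k⟩ : Cx R) = ⟨α k, |β k|⟩ := by
      ext <;> simp [abs_of_neg hk]
    rw [if_neg e1, zero_add, e2]
  · have e1 : w ≠ star ⟨α k, β k⟩ := fun he => by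
      have := congrArg QuadraticAlgebra.im he
      simp at this
      linarith
    rw [if_neg e1, add_zero, abs_of_pos hk]

/-- The number of quadratic factors of multiplicity `m`, in terms of the complex roots. -/
theorem IsFact.card_filter_cmult (h : IsFact f μ ν θ α β) (hf : f ≠ 0) (hν : ∀ k, 0 < ν k)
    (m : ℕ) : (Finset.univ.filter fun k => ν k = m).card =
      ((cxRoots f).filter fun z => f.toCx.rootMultiplicity z = m ∧ 0 < z.im).card := by
  have hfc : f.toCx ≠ 0 := Polynomial.map_ne_zero hf
  have him : ∀ k, 0 < (⟨α k, |β k|⟩ : Cx R).im := fun k => abs_pos.2 (h.im_ne k)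
  have hmult : ∀ k, f.toCx.rootMultiplicity ⟨α k, |β k|⟩ = ν k := by
    intro k
    rw [h.rootMultiplicity_upper (him k), Finset.sum_eq_single k, if_pos rfl]
    · intro l _ hl
      exact if_neg fun he => hl (h.upper_injective he).symm
    · simp
  refine Finset.card_bij (fun k _ => ⟨α k, |β k|⟩) ?_ ?_ ?_
  · intro k hk
    rw [Finset.mem_filter] at hk ⊢
    refine ⟨?_, (hmult k).trans hk.2, him k⟩
    rw [mem_cxRoots hf]
    refine (rootMultiplicity_pos hfc).1 ?_
    rw [hmult]
    exact hν k
  · intro k _ l _ he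
    exact h.upper_injective he
  · intro w hw
    rw [Finset.mem_filter, mem_cxRoots hf] at hw
    obtain ⟨hw0, hwm, hwi⟩ := hw
    have hpos := (rootMultiplicity_pos hfc).2 hw0
    obtain ⟨k, hk⟩ : ∃ k, w = ⟨α k, |β k|⟩ := by
      by_contra! hcon
      rw [h.rootMultiplicity_upper hwi, Finset.sum_eq_zero fun k _ => if_neg (hcon k)] at hpos
      exact lt_irrefl _ hpos
    refine ⟨k, Finset.mem_filter.2 ⟨Finset.mem_univ _, ?_⟩, hk.symm⟩
    rw [← hmult k, ← hk, hwm]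

omit [IsStrictOrderedRing R] in
theorem IsThom.enc_eq {p : ℕ} {D : ThomData p} {θ : Fin D.r → R} {α β : Fin D.s → R}
    (h : IsThom f D θ α β) (j : Fin D.r) : D.enc j = thomEncoding p f (θ j) :=
  funext fun i => (h.sign_eq j i).symm

theorem IsThom.mult_eq {p : ℕ} {D : ThomData p} {θ : Fin D.r → R} {α β : Fin D.s → R}
    (h : IsThom f D θ α β) (hf : f.Monic) (hp : f.natDegree = p) (hp1 : 1 ≤ p) (j : Fin D.r) :
    D.mult j = (D.enc j).mu := by
  rw [h.enc_eq, thomEncoding_mu hf hp hp1 (h.fact.eval_theta (D.mult_pos j)),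
    h.fact.rootMultiplicity_theta]

/-- The root data of a polynomial are determined by the numbers of real and complex roots with
given signs and vanishing patterns of the derivatives. -/
theorem IsThom.thomData_eq {f' : R[X]} {p : ℕ} (hp1 : 1 ≤ p) (hf : f.Monic) (hf' : f'.Monic)
    (hp : f.natDegree = p) (hp' : f'.natDegree = p) {D D' : ThomData p}
    {θ : Fin D.r → R} {α β : Fin D.s → R} {θ' : Fin D'.r → R} {α' β' : Fin D'.s → R}
    (h : IsThom f D θ α β) (h' : IsThom f' D' θ' α' β')
    (hreal : ∀ η, (f.roots.toFinset.filter fun x => thomEncoding p f x = η).card =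
      (f'.roots.toFinset.filter fun x => thomEncoding p f' x = η).card)
    (hcx : ∀ η, ((cxRoots f).filter fun z => cxPattern p f z = η).card =
      ((cxRoots f').filter fun z => cxPattern p f' z = η).card) : D = D' := by
  have henc : ∀ {g : R[X]} {E : ThomData p} {t : Fin E.r → R} {a b : Fin E.s → R}, g.Monic →
      IsThom g E t a b → ∀ η, (∃ j, E.enc j = η) ↔
        0 < (g.roots.toFinset.filter fun x => thomEncoding p g x = η).card := by
    intro g E t a b hg hE η
    rw [Finset.card_pos]
    constructor
    · rintro ⟨j, hj⟩
      refine ⟨t j, ?_⟩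
      rw [Finset.mem_filter, Multiset.mem_toFinset, mem_roots hg.ne_zero]
      exact ⟨hE.fact.eval_theta (E.mult_pos j), by rw [← hE.enc_eq, hj]⟩
    · rintro ⟨x, hx⟩
      rw [Finset.mem_filter, Multiset.mem_toFinset, mem_roots hg.ne_zero] at hx
      obtain ⟨j, rfl⟩ := hE.fact.exists_theta hg.ne_zero hx.1
      exact ⟨j, by rw [hE.enc_eq, hx.2]⟩
  -- Complex roots of multiplicity `m` are the real ones and two for each quadratic factor of
  -- exponent `m`, so the two root counts determine `cmult`.
  have hcount : ∀ {g : R[X]} {E : ThomData p} {t : Fin E.r → R} {a b : Fin E.s → R}, g.Monic →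
      g.natDegree = p → IsThom g E t a b → ∀ m,
        ((cxRoots g).filter fun z => (cxPattern p g z).mu = m).card =
          (g.roots.toFinset.filter fun x => (thomEncoding p g x).mu = m).card +
            2 * (Finset.univ.filter fun k => E.cmult k = m).card := by
    intro g E t a b hg hgp hE m
    have e1 : ((cxRoots g).filter fun z => (cxPattern p g z).mu = m) =
        (cxRoots g).filter fun z => g.toCx.rootMultiplicity z = m :=
      Finset.filter_congr fun z hz => by
        rw [cxPattern_mu hg hgp hp1 ((mem_cxRoots hg.ne_zero).1 hz)]
    have e2 : (g.roots.toFinset.filter fun x => (thomEncoding p g x).mu = m) =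
        g.roots.toFinset.filter fun x => g.toCx.rootMultiplicity (algebraMap R (Cx R) x) = m :=
      Finset.filter_congr fun x hx => by
        rw [Multiset.mem_toFinset, mem_roots hg.ne_zero] at hx
        rw [thomEncoding_mu hg hgp hp1 hx, rootMultiplicity_toCx]
    have hstar : ∀ z ∈ (cxRoots g).filter fun z => g.toCx.rootMultiplicity z = m,
        star z ∈ (cxRoots g).filter fun z => g.toCx.rootMultiplicity z = m := by
      intro z hz
      rw [Finset.mem_filter, mem_cxRoots hg.ne_zero] at hz ⊢
      refine ⟨by rw [toCx_eval_star, hz.1, star_zero], ?_⟩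
      rw [← hz.2, rootMultiplicity_toCx_star]
    rw [e1, e2, Finset.card_eq_real_add_two_mul hstar, Finset.filter_filter, Finset.filter_filter,
      card_real_roots_filter hg.ne_zero, hE.fact.card_filter_cmult hg.ne_zero E.cmult_pos]
  refine ThomData.eq_of_forall (fun η => ?_) (h.mult_eq hf hp hp1) (h'.mult_eq hf' hp' hp1)
    fun m => ?_
  · rw [henc hf h, henc hf' h', hreal]
  · have c1 := hcount hf hp h m
    have c2 := hcount hf' hp' h' m
    have c3 := card_filter_comp_eq hreal fun η => η.mu = m
    have c4 := card_filter_comp_eq hcx fun η => η.mu = m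
    omega

end Fact

/-! ### Existence of root data -/

section Existence

/-- A finite set can be enumerated by decreasing weight, and by increasing key for equal weights. -/
theorem Finset.exists_enumeration {X L : Type*} [LinearOrder L] (S : Finset X) (w : X → ℕ)
    (key : X → L) (hkey : Function.Injective key) :
    ∃ g : Fin S.card ↪ X, Finset.univ.map g = S ∧
      ∀ i j, i < j → w (g j) < w (g i) ∨ (w (g i) = w (g j) ∧ key (g i) < key (g j)) := by
  -- The order dual makes the weight decrease along the increasing lexicographic enumeration.
  let κ : X ↪ ℕᵒᵈ ×ₗ L := ⟨fun x => toLex (OrderDual.toDual (w x), key x), fun x y h =>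
    hkey (congrArg Prod.snd (toLex.injective h))⟩
  let e := (S.map κ).orderEmbOfFin (Finset.card_map κ)
  have he : ∀ i, ∃ x ∈ S, κ x = e i := fun i =>
    Finset.mem_map.1 ((S.map κ).orderEmbOfFin_mem (Finset.card_map κ) i)
  choose g hgS hg using he
  have hginj : Function.Injective g := fun i j h => e.injective (by rw [← hg, ← hg, h])
  refine ⟨⟨g, hginj⟩, ?_, fun i j hij => ?_⟩
  · refine Finset.eq_of_subset_of_card_le ?_ (by simp)
    intro x hx
    obtain ⟨i, -, rfl⟩ := Finset.mem_map.1 hx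
    exact hgS i
  · have hlt : κ (g i) < κ (g j) := by
      rw [hg, hg]
      exact e.strictMono hij
    rcases Prod.Lex.lt_iff.1 hlt with h | ⟨h1, h2⟩
    · exact Or.inl h
    · exact Or.inr ⟨h1, h2⟩

variable {R : Type*} [Field R] [LinearOrder R] [IsStrictOrderedRing R] [IsRealClosed R]

/-- Over `R(i)`, conjugate roots have equal multiplicities, so the linear factors of the lower
half-plane pair with those of the upper one. -/
theorem Polynomial.Monic.eq_prod_real_mul_prod_upper {f : R[X]} (hf : f.Monic) :
    f = (∏ x ∈ f.roots.toFinset, (X - C x) ^ f.rootMultiplicity x) *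
      ∏ z ∈ (cxRoots f).filter fun z => 0 < z.im,
        ((X - C z.re) ^ 2 + C z.im ^ 2) ^ f.toCx.rootMultiplicity z := by
  classical
  apply map_injective (algebraMap R (Cx R)) (algebraMap R (Cx R)).injective
  have hsplit : f.toCx = ∏ z ∈ cxRoots f, (X - C z) ^ f.toCx.rootMultiplicity z := by
    conv_lhs => rw [(IsAlgClosed.splits f.toCx).eq_prod_roots_of_monic (hf.map _)]
    rw [Finset.prod_multiset_map_count, cxRoots]
    exact Finset.prod_congr rfl fun z _ => by rw [count_roots]
  have hstar : ∀ z ∈ cxRoots f, star z ∈ cxRoots f := by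
    intro z hz
    rw [mem_cxRoots hf.ne_zero] at hz ⊢
    rw [toCx_eval_star, hz, star_zero]
  have hreal : ∏ z ∈ (cxRoots f).filter (fun z => z.im = 0),
      (X - C z) ^ f.toCx.rootMultiplicity z = ∏ x ∈ f.roots.toFinset,
        ((X - C (algebraMap R (Cx R) x)) ^ f.rootMultiplicity x) := by
    symm
    refine Finset.prod_bij' (fun x _ => algebraMap R (Cx R) x) (fun z _ => z.re) ?_ ?_ ?_ ?_ ?_
    · intro x hx
      rw [Multiset.mem_toFinset, mem_roots hf.ne_zero] at hx
      rw [Finset.mem_filter, mem_cxRoots hf.ne_zero, toCx_eval_algebraMap, hx.eq_zero]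
      exact ⟨map_zero _, by simp⟩
    · intro z hz
      have hz0 := (Finset.mem_filter.1 hz).2
      rw [Finset.mem_filter, mem_cxRoots hf.ne_zero, ← Cx.algebraMap_re hz0, toCx_eval_algebraMap,
        FaithfulSMul.algebraMap_eq_zero_iff] at hz
      rw [Multiset.mem_toFinset, mem_roots hf.ne_zero]
      exact hz.1
    · intro x _; simp
    · intro z hz; exact Cx.algebraMap_re (Finset.mem_filter.1 hz).2
    · intro x _; rw [rootMultiplicity_toCx]
  have hdown : ∏ z ∈ (cxRoots f).filter (fun z => z.im < 0),
      (X - C z) ^ f.toCx.rootMultiplicity z = ∏ z ∈ (cxRoots f).filter (fun z => 0 < z.im),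
        (X - C (star z)) ^ f.toCx.rootMultiplicity z := by
    refine Finset.prod_bij' (fun z _ => star z) (fun z _ => star z) ?_ ?_ ?_ ?_ ?_
    · intro z hz
      rw [Finset.mem_filter] at hz ⊢
      exact ⟨hstar z hz.1, by simpa using hz.2⟩
    · intro z hz
      rw [Finset.mem_filter] at hz ⊢
      exact ⟨hstar z hz.1, by simpa using hz.2⟩
    · intro z _; exact Cx.star_star z
    · intro z _; exact Cx.star_star z
    · intro z _; rw [Cx.star_star, rootMultiplicity_toCx_star]
  have e1 : ((cxRoots f).filter fun z => ¬ z.im = 0).filter (fun z => 0 < z.im) =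
      (cxRoots f).filter fun z => 0 < z.im := by
    rw [Finset.filter_filter]
    exact Finset.filter_congr fun z _ => ⟨fun h => h.2, fun h => ⟨h.ne', h⟩⟩
  have e2 : ((cxRoots f).filter fun z => ¬ z.im = 0).filter (fun z => ¬ 0 < z.im) =
      (cxRoots f).filter fun z => z.im < 0 := by
    rw [Finset.filter_filter]
    exact Finset.filter_congr fun z _ => ⟨fun h => lt_of_le_of_ne (not_lt.1 h.2) h.1,
      fun h => ⟨h.ne, h.not_gt⟩⟩
  have hR : ((∏ x ∈ f.roots.toFinset, (X - C x) ^ f.rootMultiplicity x) *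
      ∏ z ∈ (cxRoots f).filter fun z => 0 < z.im,
        ((X - C z.re) ^ 2 + C z.im ^ 2) ^ f.toCx.rootMultiplicity z : R[X]).map
          (algebraMap R (Cx R)) = (∏ x ∈ f.roots.toFinset,
        ((X - C (algebraMap R (Cx R) x)) ^ f.rootMultiplicity x)) *
        ((∏ z ∈ (cxRoots f).filter (fun z => 0 < z.im),
          (X - C z) ^ f.toCx.rootMultiplicity z) *
        ∏ z ∈ (cxRoots f).filter (fun z => 0 < z.im),
          (X - C (star z)) ^ f.toCx.rootMultiplicity z) := by
    rw [Polynomial.map_mul, Polynomial.map_prod, Polynomial.map_prod, ← Finset.prod_mul_distrib]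
    congr 1
    · refine Finset.prod_congr rfl fun x _ => ?_
      rw [Polynomial.map_pow, Polynomial.map_sub, map_X, map_C]
    · refine Finset.prod_congr rfl fun z _ => ?_
      rw [Polynomial.map_pow, quadFactor_map, mul_pow]
  refine Eq.trans ?_ hR.symm
  refine hsplit.trans ?_
  rw [← Finset.prod_filter_mul_prod_filter_not _ (fun z : Cx R => z.im = 0),
    ← Finset.prod_filter_mul_prod_filter_not ((cxRoots f).filter fun z => ¬ z.im = 0)
      (fun z : Cx R => 0 < z.im), e1, e2, hreal, hdown]

/-- A monic polynomial over a real closed field has root data. -/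
theorem Polynomial.Monic.exists_isThom {f : R[X]} (hf : f.Monic) {p : ℕ} (hp : f.natDegree = p)
    (hp1 : 1 ≤ p) : ∃ (D : ThomData p) (θ : Fin D.r → R) (α β : Fin D.s → R),
      IsThom f D θ α β := by
  have hfc : f.toCx ≠ 0 := (hf.map _).ne_zero
  -- Ordering by decreasing multiplicity, then by increasing value, is the order `MuPrec` of the
  -- encodings, by Thom's lemma.
  obtain ⟨g, hg, hgo⟩ := f.roots.toFinset.exists_enumeration (fun x => f.rootMultiplicity x)
    (fun x : R => x) Function.injective_id
  obtain ⟨k, hk, hko⟩ := ((cxRoots f).filter fun z => 0 < z.im).exists_enumeration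
    (fun z => f.toCx.rootMultiplicity z) (fun z => (toLex (z.re, z.im) : R ×ₗ R)) (by
      intro z w h
      have h' := toLex.injective h
      rw [Prod.mk.injEq] at h'
      exact QuadraticAlgebra.ext h'.1 h'.2)
  have hgroot : ∀ j, f.eval (g j) = 0 := fun j => by
    have := Finset.mem_map_of_mem g (Finset.mem_univ j)
    rwa [hg, Multiset.mem_toFinset, mem_roots hf.ne_zero] at this
  have hkroot : ∀ j, f.toCx.eval (k j) = 0 ∧ 0 < (k j).im := fun j => by
    have := Finset.mem_map_of_mem k (Finset.mem_univ j)
    rwa [hk, Finset.mem_filter, mem_cxRoots hf.ne_zero] at this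
  have hprod : f = (∏ j, (X - C (g j)) ^ f.rootMultiplicity (g j)) *
      ∏ j, ((X - C (k j).re) ^ 2 + C (k j).im ^ 2) ^ f.toCx.rootMultiplicity (k j) := by
    have h := hf.eq_prod_real_mul_prod_upper
    rw [← hg, ← hk, Finset.prod_map, Finset.prod_map] at h
    exact h
  have hsum : ∑ j, f.rootMultiplicity (g j) + 2 * ∑ j, f.toCx.rootMultiplicity (k j) = p := by
    have h := congrArg natDegree hprod
    rw [Monic.natDegree_mul (monic_prod_of_monic _ _ fun j _ => (monic_X_sub_C _).pow _)
      (monic_prod_of_monic _ _ fun j _ => (quadFactor_monic _ _).pow _),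
      natDegree_prod_of_monic _ _ fun j _ => (monic_X_sub_C _).pow _,
      natDegree_prod_of_monic _ _ fun j _ => (quadFactor_monic _ _).pow _] at h
    rw [hp, Finset.sum_congr rfl fun j _ => ((monic_X_sub_C (g j)).natDegree_pow _).trans
        (by rw [natDegree_X_sub_C, mul_one]),
      Finset.sum_congr rfl fun j _ => ((quadFactor_monic (k j).re (k j).im).natDegree_pow _).trans
        (by rw [quadFactor_natDegree]), ← Finset.sum_mul] at h
    omega
  have hanti : ∀ {n : ℕ} {w : Fin n → ℕ}, (∀ i j, i < j → w j ≤ w i) → Antitone w := by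
    intro n w hw i j hij
    rcases hij.eq_or_lt with rfl | h
    · exact le_rfl
    · exact hw i j h
  refine ⟨{
    r := _
    s := _
    mult := fun j => f.rootMultiplicity (g j)
    cmult := fun j => f.toCx.rootMultiplicity (k j)
    enc := fun j => thomEncoding p f (g j)
    mult_pos := fun j => (rootMultiplicity_pos hf.ne_zero).2 (hgroot j)
    mult_antitone := hanti fun i j hij => by rcases hgo i j hij with h | h <;> omega
    cmult_pos := fun j => (rootMultiplicity_pos hfc).2 (hkroot j).1
    cmult_antitone := hanti fun i j hij => by rcases hko i j hij with h | h <;> omega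
    sum_eq := hsum
    enc_injective := fun i j hij => by
      subst hp
      exact g.injective (hf.thomEncoding_injOn hp1 (hgroot i) (hgroot j) hij)
    enc_ordered := fun i j hij => by
      unfold DerSign.MuPrec
      rw [thomEncoding_mu hf hp hp1 (hgroot i), thomEncoding_mu hf hp hp1 (hgroot j)]
      rcases hgo i j hij with h | ⟨h1, h2⟩
      · exact Or.inl h
      · subst hp
        exact Or.inr ⟨h1, hf.thomEncoding_prec hp1 (hgroot i) (hgroot j) h2⟩ },
    g, fun j => (k j).re, fun j => (k j).im, ⟨hprod, ?_, ?_, ?_⟩, fun j h => rfl⟩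
  · intro i j hij h
    exact hij.ne (g.injective h)
  · intro j
    exact (hkroot j).2.ne'
  · intro i j hij h
    have hi := (hkroot i).2
    have hj := (hkroot j).2
    -- The first factor vanishes only for equal roots; the second is positive, as both imaginary
    -- parts are.
    rcases mul_eq_zero.1 h with h | h
    · have h1 : ((k i).re - (k j).re) = 0 := by nlinarith [sq_nonneg ((k i).im - (k j).im), sq_nonneg ((k i).re - (k j).re)]
      have h2 : ((k i).im - (k j).im) = 0 := by
        rw [h1] at h
        nlinarith
      exact hij.ne (k.injective (QuadraticAlgebra.ext (sub_eq_zero.1 h1) (sub_eq_zero.1 h2)))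
    · nlinarith [sq_nonneg ((k i).re - (k j).re), mul_pos (add_pos hi hj) (add_pos hi hj)]

end Existence

/-! ### Fixing the Thom encodings -/

section DerivProd

/-- The product `∏ (P^(h)) ^ a_h` over `1 ≤ h < p`. -/
noncomputable def derivProd {A : Type*} [CommRing A] {p : ℕ} (P : A[X])
    (a : Finset.Ico 1 p → ℕ) : A[X] :=
  ∏ h : Finset.Ico 1 p, (derivative^[(h : ℕ)] P) ^ a h

theorem derivProd_map {A B : Type*} [CommRing A] [CommRing B] (φ : A →+* B) {p : ℕ} (P : A[X])
    (a : Finset.Ico 1 p → ℕ) : (derivProd P a).map φ = derivProd (P.map φ) a := by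
  rw [derivProd, Polynomial.map_prod, derivProd]
  exact Finset.prod_congr rfl fun h _ => by rw [Polynomial.map_pow, iterate_derivative_map]

theorem derivProd_mem_PDer {A : Type*} [CommRing A] {P : A[X]} {a : Finset.Ico 1 P.natDegree → ℕ}
    (ha : ∀ h, a h ≤ 2) {n : ℕ} (hn : (Finset.univ.filter fun h => a h ≠ 0).card ≤ n) :
    derivProd P a ∈ PDer n P := by
  let b : ℕ → ℕ := fun h => if hh : h ∈ Finset.Ico 1 P.natDegree then a ⟨h, hh⟩ else 0
  have hb : ∀ h : Finset.Ico 1 P.natDegree, b h = a h := fun h => dif_pos h.2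
  refine ⟨b, fun h => ?_, le_trans (le_of_eq ?_) hn, ?_⟩
  · simp only [b]
    split_ifs
    · exact ha _
    · omega
  · rw [Finset.card_filter, Finset.card_filter,
      ← Finset.sum_coe_sort (Finset.Ico 1 P.natDegree)]
    exact Finset.sum_congr rfl fun h _ => by rw [hb]
  · rw [derivProd, ← Finset.prod_coe_sort (Finset.Ico 1 P.natDegree)]
    exact Finset.prod_congr rfl fun h _ => by rw [hb]

variable {R : Type*} [Field R] [LinearOrder R] [IsStrictOrderedRing R]

theorem sign_derivProd_eval {p : ℕ} (f : R[X]) (a : Finset.Ico 1 p → ℕ) (x : R) :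
    SignType.sign ((derivProd f a).eval x) = ∏ h, thomEncoding p f x h ^ a h := by
  rw [derivProd, eval_prod]
  refine (map_prod (signHom (α := R)) _ _).trans (Finset.prod_congr rfl fun h _ => ?_)
  rw [eval_pow, map_pow]
  rfl

/-- Signs are multiplicative, so Tarski queries are moments of the sign vectors of the real roots.
-/
theorem tarskiQuery_derivProd_mul {p : ℕ} (f g : R[X]) (a : Finset.Ico 1 p → ℕ) (n : ℕ) :
    tarskiQuery f (derivProd f a * g ^ n) = ∑ x ∈ f.roots.toFinset,
      (SignType.sign (g.eval x) : ℤ) ^ n * ∏ h, (thomEncoding p f x h : ℤ) ^ a h := by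
  refine Finset.sum_congr rfl fun x _ => ?_
  rw [eval_mul, eval_pow, sign_mul, sign_derivProd_eval, sign_pow, mul_comm]
  have h := map_mul (SignType.castHom (α := ℤ)) (SignType.sign (g.eval x) ^ n)
    (∏ h, thomEncoding p f x h ^ a h)
  rw [map_pow, map_prod] at h
  simp only [map_pow] at h
  exact h

/-- The rank side: the moment product of the 0/1 pattern is 1 exactly where no derivative with
positive exponent vanishes, and 0 elsewhere. -/
theorem card_cxSupport_derivProd {p : ℕ} (f : R[X]) (a : Finset.Ico 1 p → ℕ) :
    ((cxSupport f (derivProd f a)).card : ℤ) =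
      ∑ z ∈ cxRoots f, ∏ h, (cxPattern p f z h : ℤ) ^ a h := by
  rw [cxSupport, Finset.card_filter, Nat.cast_sum]
  refine Finset.sum_congr rfl fun z _ => ?_
  rw [derivProd, Polynomial.toCx, Polynomial.map_prod, eval_prod]
  simp only [Polynomial.map_pow, eval_pow, cxPattern]
  by_cases h : ∏ i : Finset.Ico 1 p, (derivative^[(i : ℕ)] f).toCx.eval z ^ a i = 0
  · obtain ⟨i, -, hi⟩ := Finset.prod_eq_zero_iff.1 h
    rw [if_neg (not_not.2 h), Finset.prod_eq_zero (Finset.mem_univ i), Nat.cast_zero]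
    rw [if_pos (eq_zero_of_pow_eq_zero hi)]
    by_cases hai : a i = 0
    · simp [hai] at hi
    · simp [hai]
  · rw [if_pos h, Finset.prod_eq_one, Nat.cast_one]
    intro i hi
    by_cases hai : a i = 0
    · simp [hai]
    · have := Finset.prod_ne_zero_iff.1 h i hi
      rw [if_neg fun h0 => this (by rw [h0, zero_pow hai])]
      simp

end DerivProd

/-! ### Constancy of the root counts on a realization -/

section Invariance

variable {k : ℕ} {K : Type*} [Field K] {R : Type*} [Field R] [LinearOrder R] [Algebra K R]

omit [LinearOrder R] in
theorem specialize_monic {P : (MvPolynomial (Fin k) K)[X]} (hP : P.Monic) (υ : Fin k → R) :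
    (specialize P υ).Monic := hP.map _

omit [LinearOrder R] in
theorem specialize_natDegree {P : (MvPolynomial (Fin k) K)[X]} (hP : P.Monic) (υ : Fin k → R) :
    (specialize P υ).natDegree = P.natDegree := hP.natDegree_map _

/-- The sign of a Hermite minor at a point realizing a sign condition on a family containing it. -/
theorem sign_hankelDet_specialize {P B : (MvPolynomial (Fin k) K)[X]} (hP : P.Monic)
    {S : Set (MvPolynomial (Fin k) K)} (hB : hermiteMinors P B ⊆ S) {τ : S → SignType}
    {υ υ' : Fin k → R} (hυ : υ ∈ signRealization R τ) (hυ' : υ' ∈ signRealization R τ) (r : ℕ)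
    (hr : 1 ≤ r) (hr' : r ≤ P.natDegree) :
    SignType.sign (hankelDet (hermiteFunctional (specialize P υ) (specialize B υ)) r) =
      SignType.sign (hankelDet (hermiteFunctional (specialize P υ') (specialize B υ')) r) := by
  have hmem := hB (hankelDet_mem_hermiteMinors hP B hr hr')
  have h1 := map_hankelDet (MvPolynomial.aeval υ : MvPolynomial (Fin k) K →ₐ[K] R).toRingHom hP B r
  have h2 := map_hankelDet (MvPolynomial.aeval υ' : MvPolynomial (Fin k) K →ₐ[K] R).toRingHom hP B r
  rw [specialize, specialize, specialize, specialize, ← h1, ← h2]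
  exact (hυ ⟨_, hmem⟩).trans (hυ' ⟨_, hmem⟩).symm

variable [IsStrictOrderedRing R] [IsRealClosed R]

theorem specialize_query_eq {P B : (MvPolynomial (Fin k) K)[X]} (hP : P.Monic)
    {S : Set (MvPolynomial (Fin k) K)} (hB : hermiteMinors P B ⊆ S) {τ : S → SignType}
    {υ υ' : Fin k → R} (hυ : υ ∈ signRealization R τ) (hυ' : υ' ∈ signRealization R τ) :
    (cxSupport (specialize P υ) (specialize B υ)).card =
        (cxSupport (specialize P υ') (specialize B υ')).card ∧
      tarskiQuery (specialize P υ) (specialize B υ) =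
        tarskiQuery (specialize P υ') (specialize B υ') :=
  card_cxSupport_and_tarskiQuery_eq (specialize_monic hP υ) (specialize_monic hP υ')
    (specialize_natDegree hP υ) (specialize_natDegree hP υ')
    (sign_hankelDet_specialize hP hB hυ hυ')

omit [IsStrictOrderedRing R] [IsRealClosed R] in
theorem card_roots_toFinset_le (f : R[X]) : f.roots.toFinset.card ≤ f.natDegree :=
  (Multiset.toFinset_card_le _).trans (card_roots' _)

variable {P Q : (MvPolynomial (Fin k) K)[X]} (hP : P.Monic) {υ υ' : Fin k → R}
  {τ : ThElim P → SignType} {τ' : ThElimWith P Q → SignType}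

include hP

theorem query_derivProd_eq (hυ : υ ∈ signRealization R τ) (hυ' : υ' ∈ signRealization R τ)
    {a : Finset.Ico 1 P.natDegree → ℕ} (ha : ∀ h, a h ≤ 2)
    (hn : (Finset.univ.filter fun h => a h ≠ 0).card ≤ Nat.size P.natDegree) :
    (cxSupport (specialize P υ) (derivProd (specialize P υ) a)).card =
        (cxSupport (specialize P υ') (derivProd (specialize P υ') a)).card ∧
      tarskiQuery (specialize P υ) (derivProd (specialize P υ) a) =
        tarskiQuery (specialize P υ') (derivProd (specialize P υ') a) := by
  have h := specialize_query_eq (B := derivProd P a) hP (S := ThElim P)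
    (Set.subset_biUnion_of_mem (u := fun B => hermiteMinors P B) (derivProd_mem_PDer ha hn))
    hυ hυ'
  rwa [specialize, specialize, specialize, specialize, derivProd_map, derivProd_map] at h

theorem card_thomEncoding_eq (hυ : υ ∈ signRealization R τ) (hυ' : υ' ∈ signRealization R τ)
    (η : DerSign P.natDegree) :
    ((specialize P υ).roots.toFinset.filter fun x =>
        thomEncoding P.natDegree (specialize P υ) x = η).card =
      ((specialize P υ').roots.toFinset.filter fun x =>
        thomEncoding P.natDegree (specialize P υ') x = η).card := by
  refine card_filter_eq_of_moments _ _ (n := P.natDegree)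
    ((card_roots_toFinset_le _).trans_eq (specialize_natDegree hP υ))
    ((card_roots_toFinset_le _).trans_eq (specialize_natDegree hP υ')) (fun a ha hn => ?_) η
  have h := (query_derivProd_eq hP hυ hυ' ha hn).2
  rw [← mul_one (derivProd (specialize P υ) a), ← mul_one (derivProd (specialize P υ') a),
    ← pow_zero 1, ← pow_zero 1, tarskiQuery_derivProd_mul, tarskiQuery_derivProd_mul] at h
  simpa only [pow_zero, one_mul] using h

theorem card_cxPattern_eq (hυ : υ ∈ signRealization R τ) (hυ' : υ' ∈ signRealization R τ)
    (η : DerSign P.natDegree) :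
    ((cxRoots (specialize P υ)).filter fun z =>
        cxPattern P.natDegree (specialize P υ) z = η).card =
      ((cxRoots (specialize P υ')).filter fun z =>
        cxPattern P.natDegree (specialize P υ') z = η).card := by
  refine card_filter_eq_of_moments _ _ (n := P.natDegree)
    ((card_cxRoots_le _).trans_eq (specialize_natDegree hP υ))
    ((card_cxRoots_le _).trans_eq (specialize_natDegree hP υ')) (fun a ha hn => ?_) η
  rw [← card_cxSupport_derivProd, ← card_cxSupport_derivProd,
    (query_derivProd_eq hP hυ hυ' ha hn).1]

/-- The Thom encoding of `x` together with the sign of `g` at `x`. -/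
noncomputable def thomEncodingWith (p : ℕ) (f g : R[X]) (x : R) :
    Option (Finset.Ico 1 p) → SignType :=
  fun o => o.elim (SignType.sign (g.eval x)) (thomEncoding p f x)

/-- Moments free of `Q` are governed by `ThElim P`. The others spend one of the `bit p` coordinates
on `Q`, so at most `bit p - 1` derivatives occur and `ThElimWith P Q` governs them. -/
theorem card_thomEncodingWith_eq
    (hυ : υ ∈ signRealization R τ ∩ signRealization R τ')
    (hυ' : υ' ∈ signRealization R τ ∩ signRealization R τ')
    (η : Option (Finset.Ico 1 P.natDegree) → SignType) :
    ((specialize P υ).roots.toFinset.filter fun x =>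
        thomEncodingWith P.natDegree (specialize P υ) (specialize Q υ) x = η).card =
      ((specialize P υ').roots.toFinset.filter fun x =>
        thomEncodingWith P.natDegree (specialize P υ') (specialize Q υ') x = η).card := by
  refine card_filter_eq_of_moments _ _ (n := P.natDegree)
    ((card_roots_toFinset_le _).trans_eq (specialize_natDegree hP υ))
    ((card_roots_toFinset_le _).trans_eq (specialize_natDegree hP υ')) (fun a ha hn => ?_) η
  have hn' : (if a none ≠ 0 then 1 else 0) +
      (Finset.univ.filter fun h => a (some h) ≠ 0).card ≤ Nat.size P.natDegree := by
    refine le_of_eq_of_le ?_ hn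
    rw [Finset.card_filter, Finset.card_filter, Fintype.sum_option]
  suffices h : tarskiQuery (specialize P υ)
        (derivProd (specialize P υ) (fun h => a (some h)) * (specialize Q υ) ^ a none) =
      tarskiQuery (specialize P υ')
        (derivProd (specialize P υ') (fun h => a (some h)) * (specialize Q υ') ^ a none) by
    rw [tarskiQuery_derivProd_mul, tarskiQuery_derivProd_mul] at h
    simpa only [Fintype.prod_option, thomEncodingWith, Option.elim] using h
  by_cases h0 : a none = 0
  · rw [h0, pow_zero, pow_zero, mul_one, mul_one]
    rw [if_neg (not_not.2 h0), zero_add] at hn'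
    exact (query_derivProd_eq hP hυ.1 hυ'.1 (fun h => ha _) hn').2
  · rw [if_pos h0] at hn'
    have hmem : derivProd P (fun h => a (some h)) * Q ^ a none ∈
        PDerWith (Nat.size P.natDegree - 1) P Q := by
      refine ⟨_, derivProd_mem_PDer (fun h => ha (some h)) (by omega), ?_⟩
      have h2 := ha none
      rcases (by omega : a none = 1 ∨ a none = 2) with h | h
      · left; rw [h, pow_one]
      · right; rw [h]
    have h := (specialize_query_eq (B := derivProd P (fun h => a (some h)) * Q ^ a none) hP
      (S := ThElimWith P Q) (Set.subset_biUnion_of_mem (u := fun B => hermiteMinors P B) hmem)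
      hυ.2 hυ'.2).2
    rwa [specialize, specialize, specialize, specialize, Polynomial.map_mul, Polynomial.map_mul,
      Polynomial.map_pow, Polynomial.map_pow, derivProd_map, derivProd_map] at h

end Invariance

theorem mainTheorem8 {k : ℕ} {K : Type*} [Field K]
    {R : Type*} [Field R] [LinearOrder R] [IsStrictOrderedRing R] [IsRealClosed R] [Algebra K R]
    (p : ℕ) (hp : 1 ≤ p)
    (P Q : (MvPolynomial (Fin k) K)[X]) (hP : P.Monic) (hdeg : P.natDegree = p)
    (τ : ThElim P → SignType) (τ' : ThElimWith P Q → SignType)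
    (hreal : (signRealization R τ ∩ signRealization R τ').Nonempty) :
    ∃ D : ThomData p,
      (FixesThom R P τ D ∧ ∀ D' : ThomData p, FixesThom R P τ D' → D' = D) ∧
      ∃! ε : Fin D.r → SignType,
        ∀ υ ∈ signRealization R τ ∩ signRealization R τ',
          ∃ (θ : Fin D.r → R) (α β : Fin D.s → R),
            IsThom (specialize P υ) D θ α β ∧
            ∀ j, SignType.sign ((specialize Q υ).eval (θ j)) = ε j := by
  subst hdeg
  obtain ⟨υ₀, hυ₀⟩ := hreal
  have hmon : ∀ υ : Fin k → R, (specialize P υ).Monic := specialize_monic hP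
  have hnat : ∀ υ : Fin k → R, (specialize P υ).natDegree = P.natDegree := specialize_natDegree hP
  have hinj : ∀ (υ : Fin k → R) {D : ThomData P.natDegree} {θ : Fin D.r → R} {α β : Fin D.s → R},
      IsThom (specialize P υ) D θ α β → ∀ {x : R} {j}, (specialize P υ).eval x = 0 →
        thomEncoding P.natDegree (specialize P υ) x = D.enc j → x = θ j := by
    intro υ D θ α β h x j hx hxj
    refine (hmon υ).thomEncoding_injOn (by rw [hnat]; exact hp) hx
      (h.fact.eval_theta (D.mult_pos j)) ?_
    rw [hnat, hxj, h.enc_eq]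
  -- The data and the signs are read off at the sample point `υ₀`; constancy of the counts carries
  -- them to every other point.
  obtain ⟨D, θ₀, α₀, β₀, h₀⟩ := (hmon υ₀).exists_isThom (hnat υ₀) hp
  have hfix : FixesThom R P τ D := by
    intro υ hυ
    obtain ⟨E, θ, α, β, h⟩ := (hmon υ).exists_isThom (hnat υ) hp
    obtain rfl : D = E := h₀.thomData_eq hp (hmon υ₀) (hmon υ) (hnat υ₀) (hnat υ) h
      (card_thomEncoding_eq hP hυ₀.1 hυ) (card_cxPattern_eq hP hυ₀.1 hυ)
    exact ⟨θ, α, β, h⟩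
  refine ⟨D, ⟨hfix, fun D' hD' => ?_⟩,
    fun j => SignType.sign ((specialize Q υ₀).eval (θ₀ j)), fun υ hυ => ?_, fun ε hε => ?_⟩
  · obtain ⟨θ, α, β, h⟩ := hD' υ₀ hυ₀.1
    exact h.thomData_eq hp (hmon υ₀) (hmon υ₀) (hnat υ₀) (hnat υ₀) h₀ (fun _ => rfl) fun _ => rfl
  · obtain ⟨θ, α, β, h⟩ := hfix υ hυ.1
    refine ⟨θ, α, β, h, fun j => ?_⟩
    -- Some root of `P(υ, y)` has the same encoding and the same sign of `Q` as `θ₀ j`; by Thom's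
    -- lemma it is `θ j`.
    have hcard := card_thomEncodingWith_eq hP hυ₀ hυ
      (thomEncodingWith P.natDegree (specialize P υ₀) (specialize Q υ₀) (θ₀ j))
    have hpos : 0 < ((specialize P υ).roots.toFinset.filter fun x =>
        thomEncodingWith P.natDegree (specialize P υ) (specialize Q υ) x =
          thomEncodingWith P.natDegree (specialize P υ₀) (specialize Q υ₀) (θ₀ j)).card := by
      rw [← hcard, Finset.card_pos]
      refine ⟨θ₀ j, ?_⟩
      rw [Finset.mem_filter, Multiset.mem_toFinset, mem_roots (hmon υ₀).ne_zero]
      exact ⟨h₀.fact.eval_theta (D.mult_pos j), rfl⟩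
    obtain ⟨x, hx⟩ := Finset.card_pos.1 hpos
    rw [Finset.mem_filter, Multiset.mem_toFinset, mem_roots (hmon υ).ne_zero] at hx
    have hxj : x = θ j := by
      refine hinj υ h hx.1 ?_
      rw [h₀.enc_eq]
      exact funext fun i => congrFun hx.2 (some i)
    rw [← hxj]
    exact congrFun hx.2 none
  -- Any admissible `θ` at `υ₀` has the encodings of `θ₀`, hence equals it, and the signs are
  -- forced.
  · obtain ⟨θ, α, β, h, hs⟩ := hε υ₀ hυ₀
    funext j
    rw [← hs j, ← hinj υ₀ h (h₀.fact.eval_theta (D.mult_pos j)) (h₀.enc_eq j).symm]
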